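/- **Proposition.** Let $(M,d)$ be a CAT($\kappa$) space ($\kappa\in\mathbb R$; for $\kappa>0$ only points at distance $<\pi/\sqrt\kappa$ are required to be joined by shortest paths), and let $\mu$ be a Borel probability measure on $M$ with finite second moments and Fréchet function $F(x)=\frac12\int_M d(x,y)^2\,\mu(dy)$. Suppose that $\mu$ is *localized*: $F$ has a unique minimizer $\bar\mu$ (the Fréchet mean), $F$ is convex along geodesics in a neighborhood of $\bar\mu$, and $\mu$-almost every point $x$ is joined to $\bar\mu$ by a unique shortest path, so that the logarithm $\log_{\bar\mu}x$ is defined $\mu$-almost surely. Suppose moreover that $M$ is a geodesic space with compact closed balls (equivalently, a complete, locally compact geodesic space), or that $\kappa\le 0$, or that $d(\bar\mu,x)<\pi/\sqrt\kappa$ for $\mu$-almost every $x$. Let $T_{\bar\mu}$ be the tangent cone of $M$ at $\bar\mu$: its elements are the products $V=rV_1$ of a direction $V_1$ (a class of unit-speed geodesics from $\bar\mu$ modulo zero angle) and a length $\|V\|=r\ge0$, all vectors of length $0$ being identified with the apex. It carries the conical metric $d_{\bar\mu}(V,W)=\sqrt{\|V\|^2+\|W\|^2-2\|V\|\|W\|\cos\angle(V,W)}$.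 Then: 1. For every $V\in T_{\bar\mu}$ the directional derivative $\nabla_{\bar\mu}F(V)=\frac{d}{dt}F(\exp_{\bar\mu}tV)|_{t=0^+}$ exists, where $t\mapsto\exp_{\bar\mu}tV$ is any constant-speed geodesic with initial tangent vector $V$ (the constant curve if $V$ is the apex), and it does not depend on the choice of this geodesic. 2. $\nabla_{\bar\mu}F$ is a convex function on $(T_{\bar\mu},d_{\bar\mu})$, that is, convex along every constant-speed (minimizing) geodesic $[0,1]\to T_{\bar\mu}$. 3. The pushforward $\hat\mu=(\log_{\bar\mu})_\sharp\mu$ is a well-defined Borel measure on $T_{\bar\mu}$ with finite second moments. For its Fréchet function $F_{\hat\mu}(U)=\frac12\int_{T_{\bar\mu}}d_{\bar\mu}(U,X)^2\,\hat\mu(dX)$ and every $V\in T_{\bar\mu}$, the derivative $\nabla_{\bar\mu}F_{\hat\mu}(V)=\frac{d}{dt}F_{\hat\mu}(tV)|_{t=0^+}$ exists, and $\nabla_{\bar\mu}F(V)=\nabla_{\bar\mu}F_{\hat\mu}(V)$. -/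

import Mathlib

open Filter Topology MeasureTheory Set

/-! ### Geodesics and convexity in metric spaces -/

/-- `c` restricted to `[0, dist p q]` is a unit-speed shortest path from `p` to `q`. -/
structure IsShortestPath {M : Type*} [MetricSpace M] (p q : M) (c : ℝ → M) : Prop where
  start : c 0 = p
  finish : c (dist p q) = q
  isometric : ∀ s ∈ Icc 0 (dist p q), ∀ t ∈ Icc 0 (dist p q), dist (c s) (c t) = |s - t|

/-- Every two points are joined by a shortest path. -/
def IsGeodesicSpace (M : Type*) [MetricSpace M] : Prop :=
  ∀ p q : M, ∃ c : ℝ → M, IsShortestPath p q c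

/-- `p` and `q` are joined by exactly one shortest path. -/
def HasUniqueShortestPath {M : Type*} [MetricSpace M] (p q : M) : Prop :=
  (∃ c : ℝ → M, IsShortestPath p q c) ∧
    ∀ c e : ℝ → M, IsShortestPath p q c → IsShortestPath p q e → EqOn c e (Icc 0 (dist p q))

/-- `c` restricted to `[0, 1]` is a (minimizing) geodesic of constant speed. -/
def IsConstSpeedGeodesic {M : Type*} [MetricSpace M] (c : ℝ → M) : Prop :=
  ∀ s ∈ Icc (0 : ℝ) 1, ∀ t ∈ Icc (0 : ℝ) 1, dist (c s) (c t) = |s - t| * dist (c 0) (c 1)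

/-- `f` is convex along every constant-speed geodesic that stays in `U`. -/
def GeodesicallyConvexOn {M : Type*} [MetricSpace M] (U : Set M) (f : M → ℝ) : Prop :=
  ∀ c : ℝ → M, IsConstSpeedGeodesic c → (∀ t ∈ Icc (0 : ℝ) 1, c t ∈ U) →
    ∀ t ∈ Icc (0 : ℝ) 1, f (c t) ≤ (1 - t) * f (c 0) + t * f (c 1)

/-! ### CAT(κ) spaces -/

/-- In the model plane of constant curvature `κ`, the length of the third side of a triangle with
two sides of lengths `a` and `b` that enclose the angle `θ`. Equivalently, the distance between the
points with polar coordinates `(a, 0)` and `(b, θ)`. -/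
noncomputable def modelSide (κ a b θ : ℝ) : ℝ :=
  if 0 < κ then
    Real.arccos (Real.cos (√κ * a) * Real.cos (√κ * b)
      + Real.sin (√κ * a) * Real.sin (√κ * b) * Real.cos θ) / √κ
  else if κ < 0 then
    Real.arcosh (Real.cosh (√(-κ) * a) * Real.cosh (√(-κ) * b)
      - Real.sinh (√(-κ) * a) * Real.sinh (√(-κ) * b) * Real.cos θ) / √(-κ)
  else √(a ^ 2 + b ^ 2 - 2 * a * b * Real.cos θ)

/-- `r` is smaller than the diameter of the model plane of curvature `κ`, which is `π / √κ` if
`0 < κ` and infinite otherwise. -/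
def LtModelDiam (κ r : ℝ) : Prop := 0 < κ → r < Real.pi / √κ

/-- CAT(κ) spaces: points at distance less than the model diameter are joined by shortest paths,
and geodesic triangles of perimeter less than twice the model diameter are not thicker than their
comparison triangles. In the comparison clause, `θ` is the angle at the vertex corresponding to `p`
in a comparison triangle in the model plane, and `modelSide κ s t θ` is the distance in that plane
between the comparison points of `c s` and `e t`. -/
structure IsCAT (κ : ℝ) (M : Type*) [MetricSpace M] : Prop where
  exists_shortestPath : ∀ p q : M, LtModelDiam κ (dist p q) → ∃ c : ℝ → M, IsShortestPath p q c
  comparison : ∀ p q r : M, LtModelDiam κ ((dist p q + dist q r + dist r p) / 2) →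
    ∀ c e : ℝ → M, IsShortestPath p q c → IsShortestPath p r e →
    ∀ θ ∈ Icc 0 Real.pi, dist q r = modelSide κ (dist p q) (dist p r) θ →
    ∀ s ∈ Icc 0 (dist p q), ∀ t ∈ Icc 0 (dist p r), dist (c s) (e t) ≤ modelSide κ s t θ

/-! ### Two facts of plane trigonometry, used for the triangle inequalities below -/

/-- Third side of a Euclidean triangle. -/
noncomputable def planeSide (a b θ : ℝ) : ℝ := √(a ^ 2 + b ^ 2 - 2 * a * b * Real.cos θ)

lemma planeSide_eq_norm (a b φ θ : ℝ) :
    planeSide a b θ = ‖(a : ℂ) * Complex.exp (φ * Complex.I)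
      - b * Complex.exp ((φ + θ : ℝ) * Complex.I)‖ := by
  have h : (a : ℂ) * Complex.exp (φ * Complex.I) - b * Complex.exp ((φ + θ : ℝ) * Complex.I)
      = Complex.exp (φ * Complex.I) * (a - b * Complex.exp (θ * Complex.I)) := by
    push_cast
    rw [add_mul, Complex.exp_add]
    ring
  rw [h, norm_mul, Complex.norm_exp_ofReal_mul_I, one_mul, planeSide, Complex.norm_eq_sqrt_sq_add_sq]
  congr 1
  simp only [Complex.exp_mul_I, Complex.sub_re, Complex.sub_im, Complex.mul_re, Complex.mul_im,
    Complex.add_re, Complex.add_im, Complex.ofReal_re, Complex.ofReal_im, Complex.I_re,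
    Complex.I_im, ← Complex.ofReal_cos, ← Complex.ofReal_sin]
  nlinarith [Real.sin_sq_add_cos_sq θ]

lemma planeSide_triangle (a b c α β : ℝ) :
    planeSide a c (α + β) ≤ planeSide a b α + planeSide b c β := by
  rw [planeSide_eq_norm a c 0, planeSide_eq_norm a b 0, planeSide_eq_norm b c α]
  simp only [zero_add]
  exact norm_sub_le_norm_sub_add_norm_sub _ _ _

lemma planeSide_mono {a b : ℝ} (ha : 0 ≤ a) (hb : 0 ≤ b) {α β : ℝ} (h0 : 0 ≤ α) (hab : α ≤ β)
    (hπ : β ≤ Real.pi) : planeSide a b α ≤ planeSide a b β := by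
  have := Real.cos_le_cos_of_nonneg_of_le_pi h0 hπ hab
  have h2 := mul_le_mul_of_nonneg_left this (mul_nonneg ha hb)
  exact Real.sqrt_le_sqrt (by nlinarith)

lemma planeSide_split {a c α β : ℝ} (ha : 0 < a) (hc : 0 < c) (hα : 0 < α) (hβ : 0 < β)
    (h : α + β < Real.pi) :
    ∃ b, 0 < b ∧ b ≤ max a c ∧ planeSide a b α + planeSide b c β = planeSide a c (α + β) := by
  have hsα : 0 < Real.sin α := Real.sin_pos_of_pos_of_lt_pi hα (by linarith)
  have hsβ : 0 < Real.sin β := Real.sin_pos_of_pos_of_lt_pi hβ (by linarith)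
  have hs : 0 < Real.sin (α + β) := Real.sin_pos_of_pos_of_lt_pi (by linarith) h
  set D := a * Real.sin α + c * Real.sin β with hD
  have hDpos : 0 < D := by positivity
  set l := c * Real.sin β / D with hl
  set m := a * Real.sin α / D with hm
  have hl0 : 0 ≤ l := by positivity
  have hm0 : 0 ≤ m := by positivity
  have hlm : l + m = 1 := by rw [hl, hm]; field_simp; rw [hD]; ring
  set b := a * c * Real.sin (α + β) / D with hb
  have hb0 : 0 < b := by positivity
  have key : (b : ℂ) * Complex.exp (α * Complex.I)
      = l * a + m * (c * Complex.exp ((α + β : ℝ) * Complex.I)) := by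
    have hDne : D ≠ 0 := hDpos.ne'
    apply Complex.ext
    · simp only [Complex.exp_mul_I, Complex.mul_re, Complex.mul_im, Complex.add_re, Complex.add_im,
        Complex.ofReal_re, Complex.ofReal_im, Complex.I_re, Complex.I_im, ← Complex.ofReal_cos,
        ← Complex.ofReal_sin]
      rw [hb, hl, hm, Real.sin_add, Real.cos_add]
      field_simp
      linear_combination (a * c * Real.sin β) * Real.sin_sq_add_cos_sq α
    · simp only [Complex.exp_mul_I, Complex.mul_re, Complex.mul_im, Complex.add_re, Complex.add_im,
        Complex.ofReal_re, Complex.ofReal_im, Complex.I_re, Complex.I_im, ← Complex.ofReal_cos,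
        ← Complex.ofReal_sin]
      rw [hb, hl, hm]
      field_simp
      ring
  have hlm' : (l : ℂ) + m = 1 := by exact_mod_cast hlm
  refine ⟨b, hb0, ?_, ?_⟩
  · have h1 : ‖(b : ℂ) * Complex.exp (α * Complex.I)‖ = b := by
      rw [norm_mul, Complex.norm_exp_ofReal_mul_I, mul_one, Complex.norm_real,
        Real.norm_of_nonneg hb0.le]
    rw [← h1, key]
    refine (norm_add_le _ _).trans ?_
    rw [norm_mul, norm_mul, norm_mul, Complex.norm_exp_ofReal_mul_I, mul_one, Complex.norm_real,
      Complex.norm_real, Complex.norm_real, Complex.norm_real, Real.norm_of_nonneg hl0,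
      Real.norm_of_nonneg hm0, Real.norm_of_nonneg ha.le, Real.norm_of_nonneg hc.le]
    nlinarith [le_max_left a c, le_max_right a c]
  · rw [planeSide_eq_norm a b 0, planeSide_eq_norm b c α, planeSide_eq_norm a c 0]
    simp only [zero_add, Complex.ofReal_zero, zero_mul, Complex.exp_zero, mul_one]
    rw [key]
    have e1 : (a : ℂ) - (l * a + m * (c * Complex.exp ((α + β : ℝ) * Complex.I)))
        = m * (a - c * Complex.exp ((α + β : ℝ) * Complex.I)) := by
      linear_combination (-(a : ℂ)) * hlm'
    have e2 : (l * a + m * (c * Complex.exp ((α + β : ℝ) * Complex.I)))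
        - c * Complex.exp ((α + β : ℝ) * Complex.I)
        = l * (a - c * Complex.exp ((α + β : ℝ) * Complex.I)) := by
      linear_combination (c * Complex.exp ((α + β : ℝ) * Complex.I)) * hlm'
    rw [e1, e2, norm_mul, norm_mul, Complex.norm_real, Complex.norm_real,
      Real.norm_of_nonneg hl0, Real.norm_of_nonneg hm0, ← add_mul, add_comm m l, hlm, one_mul]

/-! ### Directions and the tangent cone -/

/-- A geodesic `[0, length) → M` emanating from `p`, parametrized by arclength. -/
structure GeodesicFrom {M : Type*} [MetricSpace M] (p : M) where
  toFun : ℝ → M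
  length : ℝ
  length_pos : 0 < length
  start : toFun 0 = p
  isometric : ∀ s ∈ Ico 0 length, ∀ t ∈ Ico 0 length, dist (toFun s) (toFun t) = |s - t|

namespace GeodesicFrom

variable {M : Type*} [MetricSpace M] {p : M}

/-- The Euclidean comparison angle of `γ s` and `η t`. -/
noncomputable def compAngle (γ η : GeodesicFrom p) (s t : ℝ) : ℝ :=
  Real.arccos ((s ^ 2 + t ^ 2 - dist (γ.toFun s) (η.toFun t) ^ 2) / (2 * s * t))

/-- The (Alexandrov) angle between two geodesics from `p`. It is written as an upper limit, so that
it makes sense in every metric space; in a CAT(κ) space the limit exists. -/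
noncomputable def angle (γ η : GeodesicFrom p) : ℝ :=
  limsup (fun x : ℝ × ℝ => compAngle γ η x.1 x.2) (𝓝[>] (0 : ℝ) ×ˢ 𝓝[>] (0 : ℝ))

lemma isBoundedUnder_compAngle (γ η : GeodesicFrom p) (l : Filter (ℝ × ℝ)) :
    IsBoundedUnder (· ≤ ·) l (fun x : ℝ × ℝ => compAngle γ η x.1 x.2) :=
  isBoundedUnder_of ⟨Real.pi, fun _ => Real.arccos_le_pi _⟩

lemma isCoboundedUnder_compAngle (γ η : GeodesicFrom p) (l : Filter (ℝ × ℝ)) [l.NeBot] :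
    IsCoboundedUnder (· ≤ ·) l (fun x : ℝ × ℝ => compAngle γ η x.1 x.2) :=
  IsBoundedUnder.isCoboundedUnder_le
    (isBoundedUnder_of ⟨0, fun _ => Real.arccos_nonneg _⟩)

lemma angle_nonneg (γ η : GeodesicFrom p) : 0 ≤ angle γ η :=
  le_limsup_of_frequently_le (Frequently.of_forall fun _ => Real.arccos_nonneg _)
    (isBoundedUnder_compAngle γ η _)

lemma angle_le_pi (γ η : GeodesicFrom p) : angle γ η ≤ Real.pi :=
  limsup_le_of_le (isCoboundedUnder_compAngle γ η _)
    (Eventually.of_forall fun _ => Real.arccos_le_pi _)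

lemma angle_comm (γ η : GeodesicFrom p) : angle γ η = angle η γ := by
  have h : (fun x : ℝ × ℝ => compAngle γ η x.1 x.2)
      = (fun x : ℝ × ℝ => compAngle η γ x.1 x.2) ∘ Prod.swap := by
    funext x
    simp only [compAngle, Function.comp, Prod.fst_swap, Prod.snd_swap, dist_comm (γ.toFun x.1)]
    ring_nf
  unfold angle
  rw [h]
  conv_rhs => rw [Filter.prod_comm]
  rfl

lemma angle_self (γ : GeodesicFrom p) : angle γ γ = 0 := by
  have h0 : ∀ᶠ s : ℝ in 𝓝[>] 0, s ∈ Ioo 0 γ.length := Ioo_mem_nhdsGT γ.length_pos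
  have h : (fun x : ℝ × ℝ => compAngle γ γ x.1 x.2) =ᶠ[𝓝[>] (0 : ℝ) ×ˢ 𝓝[>] (0 : ℝ)]
      fun _ => (0 : ℝ) := by
    filter_upwards [h0.prod_mk h0] with x hx
    obtain ⟨⟨h1, h2⟩, h3, h4⟩ := hx
    have : (x.1 ^ 2 + x.2 ^ 2 - |x.1 - x.2| ^ 2) / (2 * x.1 * x.2) = 1 := by
      rw [sq_abs, div_eq_one_iff_eq (by positivity)]
      ring
    rw [compAngle, γ.isometric _ ⟨h1.le, h2⟩ _ ⟨h3.le, h4⟩, this, Real.arccos_one]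
  rw [angle, limsup_congr h, limsup_const]

lemma dist_le_of_compAngle_lt {γ η : GeodesicFrom p} {s t θ : ℝ} (hs : 0 < s) (ht : 0 < t)
    (hθ : θ ≤ Real.pi) (h : compAngle γ η s t < θ) :
    dist (γ.toFun s) (η.toFun t) ≤ planeSide s t θ := by
  have h0 : 0 ≤ θ := (Real.arccos_nonneg _).trans h.le
  have hc : Real.cos θ < (s ^ 2 + t ^ 2 - dist (γ.toFun s) (η.toFun t) ^ 2) / (2 * s * t) := by
    by_contra! hcon
    have := Real.arccos_le_arccos hcon
    rw [Real.arccos_cos h0 hθ] at this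
    exact absurd h (not_lt.mpr this)
  rw [lt_div_iff₀ (by positivity)] at hc
  exact Real.le_sqrt_of_sq_le (by nlinarith)

lemma lt_dist_of_lt_compAngle {γ η : GeodesicFrom p} {s t θ : ℝ} (hs : 0 < s) (ht : 0 < t)
    (h0 : 0 ≤ θ) (h : θ < compAngle γ η s t) :
    planeSide s t θ < dist (γ.toFun s) (η.toFun t) := by
  have hθ : θ ≤ Real.pi := h.le.trans (Real.arccos_le_pi _)
  have hc : (s ^ 2 + t ^ 2 - dist (γ.toFun s) (η.toFun t) ^ 2) / (2 * s * t) < Real.cos θ := by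
    by_contra! hcon
    have := Real.arccos_le_arccos hcon
    rw [Real.arccos_cos h0 hθ] at this
    exact absurd h (not_lt.mpr this)
  rw [div_lt_iff₀ (by positivity)] at hc
  have hd : 0 < dist (γ.toFun s) (η.toFun t) := by
    refine lt_of_le_of_ne dist_nonneg fun he => ?_
    rw [← he] at hc
    nlinarith [Real.cos_le_one θ, mul_pos hs ht, sq_nonneg (s - t)]
  exact (Real.sqrt_lt' hd).mpr (by nlinarith)

lemma angle_triangle (γ η ζ : GeodesicFrom p) : angle γ ζ ≤ angle γ η + angle η ζ := by
  by_contra! hcon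
  set δ := (angle γ ζ - angle γ η - angle η ζ) / 3 with hδ
  have hδ0 : 0 < δ := by rw [hδ]; linarith
  set α := angle γ η + δ with hα
  set β := angle η ζ + δ with hβ
  have hα0 : 0 < α := by have := angle_nonneg γ η; rw [hα]; linarith
  have hβ0 : 0 < β := by have := angle_nonneg η ζ; rw [hβ]; linarith
  have hαβ : α + β < angle γ ζ := by rw [hα, hβ]; linarith
  have hπ := angle_le_pi γ ζ
  have e1 : ∀ᶠ x : ℝ × ℝ in 𝓝[>] (0 : ℝ) ×ˢ 𝓝[>] (0 : ℝ), compAngle γ η x.1 x.2 < α :=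
    eventually_lt_of_limsup_lt (show angle γ η < α by rw [hα]; linarith)
      (isBoundedUnder_compAngle γ η _)
  have e2 : ∀ᶠ x : ℝ × ℝ in 𝓝[>] (0 : ℝ) ×ˢ 𝓝[>] (0 : ℝ), compAngle η ζ x.1 x.2 < β :=
    eventually_lt_of_limsup_lt (show angle η ζ < β by rw [hβ]; linarith)
      (isBoundedUnder_compAngle η ζ _)
  have hb := (nhdsGT_basis (0 : ℝ)).prod_self
  obtain ⟨ε, hε, hε'⟩ := (hb.eventually_iff.mp (e1.and e2))
  have e3 : ∃ᶠ x : ℝ × ℝ in 𝓝[>] (0 : ℝ) ×ˢ 𝓝[>] (0 : ℝ), α + β < compAngle γ ζ x.1 x.2 :=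
    frequently_lt_of_lt_limsup (isCoboundedUnder_compAngle γ ζ _) hαβ
  obtain ⟨⟨a, c⟩, hlt, hac⟩ := (e3.and_eventually (hb.mem_of_mem hε)).exists
  obtain ⟨ha, hc⟩ := hac
  simp only [mem_Ioo] at ha hc
  obtain ⟨b, hb0, hbm, hsum⟩ := planeSide_split ha.1 hc.1 hα0 hβ0 (by linarith)
  have hbε : b ∈ Ioo 0 ε := ⟨hb0, hbm.trans_lt (max_lt ha.2 hc.2)⟩
  have h1 := dist_le_of_compAngle_lt ha.1 hb0 (by linarith)
    (hε' (show ((a, b) : ℝ × ℝ) ∈ _ from ⟨ha, hbε⟩)).1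
  have h2 := dist_le_of_compAngle_lt hb0 hc.1 (by linarith)
    (hε' (show ((b, c) : ℝ × ℝ) ∈ _ from ⟨hbε, hc⟩)).2
  have h3 := lt_dist_of_lt_compAngle ha.1 hc.1 (by linarith) hlt
  have h4 := dist_triangle (γ.toFun a) (η.toFun b) (ζ.toFun c)
  linarith

/-- Geodesics from `p` are equivalent if the angle between them is zero. -/
instance directionSetoid (p : M) : Setoid (GeodesicFrom p) where
  r γ η := angle γ η = 0
  iseqv :=
    { refl := angle_self
      symm := fun {γ η} h => (angle_comm η γ).trans h
      trans := fun {γ η ζ} h h' => le_antisymm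
        (by have := angle_triangle γ η ζ; rw [h, h'] at this; linarith) (angle_nonneg γ ζ) }

lemma angle_congr {γ γ' η η' : GeodesicFrom p} (h : γ ≈ γ') (h' : η ≈ η') :
    angle γ η = angle γ' η' := by
  have h1 : angle γ γ' = 0 := h
  have h2 : angle η η' = 0 := h'
  have a1 := angle_triangle γ γ' η
  have a2 := angle_triangle γ' η' η
  have a3 := angle_triangle γ' γ η'
  have a4 := angle_triangle γ η η'
  rw [angle_comm η' η] at a2
  rw [angle_comm γ' γ] at a3
  exact le_antisymm (by linarith) (by linarith)

end GeodesicFrom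

/-- The space of directions at `p`. -/
def Direction {M : Type*} [MetricSpace M] (p : M) : Type _ :=
  Quotient (GeodesicFrom.directionSetoid p)

namespace Direction

variable {M : Type*} [MetricSpace M] {p : M}

/-- The direction of a geodesic. -/
def mk (γ : GeodesicFrom p) : Direction p := Quotient.mk _ γ

/-- The angle between two directions. -/
noncomputable def angle (V W : Direction p) : ℝ :=
  Quotient.lift₂ GeodesicFrom.angle
    (fun _ _ _ _ h h' => GeodesicFrom.angle_congr h h') V W

lemma angle_mk (γ η : GeodesicFrom p) : angle (mk γ) (mk η) = GeodesicFrom.angle γ η := rfl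

lemma angle_nonneg (V W : Direction p) : 0 ≤ angle V W :=
  Quotient.inductionOn₂ V W GeodesicFrom.angle_nonneg

lemma angle_le_pi (V W : Direction p) : angle V W ≤ Real.pi :=
  Quotient.inductionOn₂ V W GeodesicFrom.angle_le_pi

lemma angle_comm (V W : Direction p) : angle V W = angle W V :=
  Quotient.inductionOn₂ V W GeodesicFrom.angle_comm

lemma angle_self (V : Direction p) : angle V V = 0 :=
  Quotient.inductionOn V GeodesicFrom.angle_self

lemma angle_triangle (U V W : Direction p) : angle U W ≤ angle U V + angle V W :=
  Quotient.inductionOn₃ U V W GeodesicFrom.angle_triangle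

lemma eq_of_angle_eq_zero {V W : Direction p} : angle V W = 0 → V = W :=
  Quotient.inductionOn₂ V W fun _ _ h => Quotient.sound h

end Direction

/-- The tangent cone at `p`: pairs of a direction and a length in `[0, ∞)`, where all pairs of
length zero are identified to the apex (which is present even if there are no directions). -/
inductive TangentCone {M : Type*} [MetricSpace M] (p : M) : Type _
  | apex : TangentCone p
  | ray (V : Direction p) (r : ℝ) (hr : 0 < r) : TangentCone p

namespace TangentCone

variable {M : Type*} [MetricSpace M] {p : M}

/-- The length of a tangent vector. -/
def length : TangentCone p → ℝ
  | apex => 0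
  | ray _ r _ => r

/-- The inner product `‖V‖ ‖W‖ cos ∠(V, W)`. -/
noncomputable def innerProd : TangentCone p → TangentCone p → ℝ
  | ray V r _, ray W s _ => r * s * Real.cos (Direction.angle V W)
  | apex, _ => 0
  | ray _ _ _, apex => 0

/-- Multiplication of a tangent vector by a scalar `t ≥ 0` (and zero for `t < 0`). -/
noncomputable def scale (t : ℝ) : TangentCone p → TangentCone p
  | apex => apex
  | ray V r hr => if ht : 0 < t then ray V (t * r) (mul_pos ht hr) else apex

/-- The conical metric. -/
noncomputable def coneDist (V W : TangentCone p) : ℝ :=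
  √(V.length ^ 2 + W.length ^ 2 - 2 * innerProd V W)

lemma coneDist_ray (V W : Direction p) {r s : ℝ} (hr : 0 < r) (hs : 0 < s) :
    coneDist (ray V r hr) (ray W s hs) = planeSide r s (Direction.angle V W) := by
  simp only [coneDist, planeSide, length, innerProd]
  congr 1
  ring

lemma coneDist_apex_left (V : TangentCone p) : coneDist apex V = V.length := by
  cases V with
  | apex => simp [coneDist, length, innerProd]
  | ray V r hr => simp [coneDist, length, innerProd, Real.sqrt_sq hr.le]

lemma coneDist_comm (V W : TangentCone p) : coneDist V W = coneDist W V := by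
  cases V <;> cases W <;>
    simp only [coneDist, length, innerProd, Direction.angle_comm] <;> congr 1 <;> ring_nf

lemma planeSide_pi {r s : ℝ} (hr : 0 ≤ r) (hs : 0 ≤ s) : planeSide r s Real.pi = r + s := by
  rw [planeSide, Real.cos_pi, ← Real.sqrt_sq (add_nonneg hr hs)]
  congr 1
  ring

lemma planeSide_zero (r s : ℝ) : planeSide r s 0 = |r - s| := by
  rw [planeSide, Real.cos_zero, ← Real.sqrt_sq_eq_abs]
  congr 1
  ring

lemma coneDist_triangle (U V W : TangentCone p) :
    coneDist U W ≤ coneDist U V + coneDist V W := by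
  rcases U with _ | ⟨U, r, hr⟩ <;> rcases V with _ | ⟨V, s, hs⟩ <;> rcases W with _ | ⟨W, t, ht⟩ <;>
    simp only [coneDist_ray, coneDist_apex_left, coneDist_comm _ apex, length]
  · simp
  · simp
  · linarith
  · have := planeSide_mono hs.le ht.le le_rfl (Direction.angle_nonneg V W)
      (Direction.angle_le_pi V W)
    rw [planeSide_zero] at this
    have := neg_abs_le (s - t)
    linarith
  · simp
  · have := planeSide_mono hr.le ht.le (Direction.angle_nonneg U W)
      (Direction.angle_le_pi U W) le_rfl
    rwa [planeSide_pi hr.le ht.le] at this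
  · have := planeSide_mono hr.le hs.le le_rfl (Direction.angle_nonneg U V)
      (Direction.angle_le_pi U V)
    rw [planeSide_zero] at this
    have := le_abs_self (r - s)
    linarith
  · have hβ : min (Direction.angle V W) (Real.pi - Direction.angle U V) ≤ Direction.angle V W :=
      min_le_left _ _
    have hle : Direction.angle U W
        ≤ Direction.angle U V + min (Direction.angle V W) (Real.pi - Direction.angle U V) := by
      rw [← min_add_add_left]
      exact le_min (Direction.angle_triangle U V W)
        (by have := Direction.angle_le_pi U W; linarith)
    have hπ : Direction.angle U V + min (Direction.angle V W) (Real.pi - Direction.angle U V)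
        ≤ Real.pi := by
      have := min_le_right (Direction.angle V W) (Real.pi - Direction.angle U V)
      linarith
    have h0 : 0 ≤ min (Direction.angle V W) (Real.pi - Direction.angle U V) :=
      le_min (Direction.angle_nonneg V W) (by have := Direction.angle_le_pi U V; linarith)
    calc planeSide r t (Direction.angle U W)
        ≤ planeSide r t (Direction.angle U V
            + min (Direction.angle V W) (Real.pi - Direction.angle U V)) :=
          planeSide_mono hr.le ht.le (Direction.angle_nonneg U W) hle hπ
      _ ≤ _ := planeSide_triangle r s t _ _
      _ ≤ _ := by
          gcongr
          exact planeSide_mono hs.le ht.le h0 hβ (Direction.angle_le_pi V W)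

lemma eq_of_coneDist_eq_zero {V W : TangentCone p} (h : coneDist V W = 0) : V = W := by
  rcases V with _ | ⟨V, s, hs⟩ <;> rcases W with _ | ⟨W, t, ht⟩
  · rfl
  · rw [coneDist_apex_left, length] at h
    exact absurd h ht.ne'
  · rw [coneDist_comm, coneDist_apex_left, length] at h
    exact absurd h hs.ne'
  · have hst := mul_pos hs ht
    have hc := Real.cos_le_one (Direction.angle V W)
    have h1 : s ^ 2 + t ^ 2 - 2 * s * t * Real.cos (Direction.angle V W) = 0 := by
      rw [coneDist_ray, planeSide, Real.sqrt_eq_zero'] at h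
      nlinarith [sq_nonneg (s - t)]
    have h2 : s = t := by
      have : (s - t) ^ 2 = 0 := le_antisymm (by nlinarith) (sq_nonneg _)
      linarith [pow_eq_zero_iff (two_ne_zero) |>.mp this]
    subst h2
    have h3 : Real.cos (Direction.angle V W) = 1 := by
      have : s * s * (1 - Real.cos (Direction.angle V W)) = 0 := by nlinarith
      rcases mul_eq_zero.mp this with h | h
      · exact absurd h hst.ne'
      · linarith
    have h4 : Direction.angle V W = 0 := by
      have := Real.arccos_cos (Direction.angle_nonneg V W) (Direction.angle_le_pi V W)
      rw [h3, Real.arccos_one] at this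
      exact this.symm
    rw [Direction.eq_of_angle_eq_zero h4]

noncomputable instance : MetricSpace (TangentCone p) where
  dist := coneDist
  dist_self V := by
    show coneDist V V = 0
    rcases V with _ | ⟨V, s, hs⟩
    · rw [coneDist_apex_left, length]
    · rw [coneDist_ray, Direction.angle_self, planeSide_zero, sub_self, abs_zero]
  dist_comm := coneDist_comm
  dist_triangle := coneDist_triangle
  eq_of_dist_eq_zero := eq_of_coneDist_eq_zero

/-- The tangent cone carries the Borel σ-algebra of the conical metric. -/
noncomputable instance : MeasurableSpace (TangentCone p) := borel _

instance : BorelSpace (TangentCone p) := ⟨rfl⟩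

end TangentCone

/-! ### The logarithm map -/

/-- A shortest path between distinct points, as a geodesic that emanates from its first point. -/
def IsShortestPath.toGeodesicFrom {M : Type*} [MetricSpace M] {p q : M} {c : ℝ → M}
    (h : IsShortestPath p q c) (hpq : p ≠ q) : GeodesicFrom p where
  toFun := c
  length := dist p q
  length_pos := dist_pos.mpr hpq
  start := h.start
  isometric s hs t ht := h.isometric s (Ico_subset_Icc_self hs) t (Ico_subset_Icc_self ht)

open Classical in
/-- The logarithm map at `p`. It sends a point `x` with a unique shortest path from `p` to the
tangent vector of length `dist p x` in the direction of that path; in particular `p` is sent to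
the apex. Points without a unique shortest path get the value `apex`, which has no meaning. -/
noncomputable def logMap {M : Type*} [MetricSpace M] (p x : M) : TangentCone p :=
  if h : HasUniqueShortestPath p x ∧ p ≠ x then
    TangentCone.ray (Direction.mk (h.1.1.choose_spec.toGeodesicFrom h.2)) (dist p x)
      (dist_pos.mpr h.2)
  else TangentCone.apex

/-! ### Fréchet functions, localized measures and directional derivatives -/

/-- Finite second moments, so that the Fréchet function is finite. -/
def HasFiniteSecondMoment {M : Type*} [MetricSpace M] [MeasurableSpace M] (μ : Measure M) : Prop :=
  ∀ x : M, Integrable (fun y => dist x y ^ 2) μ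

/-- The Fréchet function of `μ`. -/
noncomputable def frechetFunction {M : Type*} [MetricSpace M] [MeasurableSpace M] (μ : Measure M)
    (x : M) : ℝ :=
  (1 / 2) * ∫ y, dist x y ^ 2 ∂μ

/-- `μ` is punctual with Fréchet mean `p`: the point `p` is the unique minimizer of the Fréchet
function, and the Fréchet function is convex along geodesics in a neighborhood of `p`. -/
structure IsPunctual {M : Type*} [MetricSpace M] [MeasurableSpace M] (μ : Measure M) (p : M) :
    Prop where
  unique_mean : ∀ x : M, x ≠ p → frechetFunction μ p < frechetFunction μ x
  locally_convex : ∃ U ∈ 𝓝 p, GeodesicallyConvexOn U (frechetFunction μ)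

/-- The logarithm map at `p` is uniquely defined `μ`-almost surely. -/
def IsRetractable {M : Type*} [MetricSpace M] [MeasurableSpace M] (μ : Measure M) (p : M) : Prop :=
  ∀ᵐ x ∂μ, HasUniqueShortestPath p x

/-- `μ` is localized with Fréchet mean `p`. -/
structure IsLocalized {M : Type*} [MetricSpace M] [MeasurableSpace M] (μ : Measure M) (p : M) :
    Prop where
  punctual : IsPunctual μ p
  retractable : IsRetractable μ p

/-- The pushforward of `μ` to the tangent cone at `p` under the logarithm map. -/
noncomputable def tangentialPushforward {M : Type*} [MetricSpace M] [MeasurableSpace M]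
    (μ : Measure M) (p : M) : Measure (TangentCone p) :=
  μ.map (logMap p)

/-- The curve `t ↦ exp_p (t V)`, for small `t ≥ 0`: a constant-speed geodesic with initial tangent
vector `V`, and the constant curve `p` if `V` is the apex. -/
noncomputable def expCurve {M : Type*} [MetricSpace M] {p : M} : TangentCone p → ℝ → M
  | TangentCone.apex => fun _ => p
  | TangentCone.ray V r _ => fun t => (Quotient.out V).toFun (r * t)

/-- The directional derivative at `p` of a function on `M`, as a function on the tangent cone. -/
noncomputable def dirDeriv {M : Type*} [MetricSpace M] {p : M} (F : M → ℝ) (V : TangentCone p) :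
    ℝ :=
  derivWithin (fun t : ℝ => F (expCurve V t)) (Ici 0) 0

/-- The directional derivative at the apex of a function on the tangent cone. -/
noncomputable def coneDirDeriv {M : Type*} [MetricSpace M] {p : M} (F : TangentCone p → ℝ)
    (V : TangentCone p) : ℝ :=
  derivWithin (fun t : ℝ => F (V.scale t)) (Ici 0) 0

/-! Everything reduces to one formula: `∇F(V) = -∫ ⟨V, log x⟩ μ(dx)`, where `⟨·,·⟩` is `innerProd`
on the cone and the logarithm is taken at the mean `p`. Its right side sees only the tangent vector,
so the derivative exists and does not depend on the geodesic. On the cone, `F_μ̂(tV)` is for `t ≥ 0`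
an exact quadratic polynomial in `t` with the same linear coefficient, so the two derivatives agree.
Convexity of `∇F` is concavity of `V ↦ ⟨V, X⟩` for each `X`, integrated.

The formula is the first variation of `d(·, x)² / 2` (`IsCAT.tendsto_slope_dist_sq`), integrated by
dominated convergence. The upper bound on the slope of `d(·, x)` along `γ` is a triangle inequality
through the point at distance `√t` from `p` on the shortest path to `x`. The lower bound needs
stability: shortest paths from `x` to `γ t` approach the one from `x` to `p`
(`IsCAT.eventually_dist_lt`). Below the model diameter this is triangle comparison; in a proper
geodesic space it is compactness plus uniqueness. The same stability makes the logarithm continuous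
along points with a unique shortest path, hence almost everywhere measurable.

Concavity comes from the CN inequality of the cone, which the cone inherits from small triangles of
`M` because it is the blow-up of `M` at `p`. Testing that inequality against `sX` and letting `s →
∞`, the terms quadratic in `s` cancel and the linear terms are the claim.

Small-scale geometry passes through `AlmostFlat`. The quotient `(d(c s, e t)² - (s - t)²) / (2 s t)`
is `1 - cos` of the Euclidean comparison angle, and CAT(κ) makes it monotone along a pair of short
paths up to a factor `l`, which can be taken arbitrarily close to `1` at small enough scale. -/

/-! ### Model plane trigonometry -/

/-- The generalized sine function of curvature `κ`. -/
noncomputable def modelSin (κ x : ℝ) : ℝ :=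
  if 0 < κ then Real.sin (√κ * x) / √κ
  else if κ < 0 then Real.sinh (√(-κ) * x) / √(-κ)
  else x

lemma modelSin_zero (κ : ℝ) : modelSin κ 0 = 0 := by simp [modelSin]

lemma hasDerivAt_modelSin_zero (κ : ℝ) : HasDerivAt (modelSin κ) 1 0 := by
  rcases lt_trichotomy κ 0 with h | h | h
  · have hk : 0 < √(-κ) := Real.sqrt_pos.mpr (by linarith)
    have e : modelSin κ = fun x => Real.sinh (√(-κ) * x) / √(-κ) := by
      funext x; simp [modelSin, h, h.le.not_gt]
    rw [e]
    simpa [hk.ne'] using (((hasDerivAt_id (0 : ℝ)).const_mul √(-κ)).sinh).div_const √(-κ)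
  · have e : modelSin κ = id := by
      funext x; simp [modelSin, h]
    rw [e]
    exact hasDerivAt_id 0
  · have hk : 0 < √κ := Real.sqrt_pos.mpr h
    have e : modelSin κ = fun x => Real.sin (√κ * x) / √κ := by
      funext x; simp [modelSin, h]
    rw [e]
    simpa [hk.ne'] using (((hasDerivAt_id (0 : ℝ)).const_mul √κ).sin).div_const √κ

lemma continuous_modelSin (κ : ℝ) : Continuous (modelSin κ) := by
  unfold modelSin
  split_ifs <;> fun_prop

lemma modelSin_pos {κ x : ℝ} (hx : 0 < x) (h : LtModelDiam κ x) : 0 < modelSin κ x := by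
  unfold modelSin
  split_ifs with h1 h2
  · have hk : 0 < √κ := Real.sqrt_pos.mpr h1
    have := h h1
    rw [lt_div_iff₀ hk] at this
    exact div_pos (Real.sin_pos_of_pos_of_lt_pi (by positivity) (by linarith)) hk
  · have hk : 0 < √(-κ) := Real.sqrt_pos.mpr (by linarith)
    exact div_pos (Real.sinh_pos_iff.mpr (by positivity)) hk
  · exact hx

/-- For `κ > 0` the model sine increases only up to half the model diameter; in the application `y`
is half of a model side, so the bound is available. -/
lemma modelSin_le_modelSin {κ x y : ℝ} (hx : 0 ≤ x) (hxy : x ≤ y)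
    (h : 0 < κ → y ≤ Real.pi / √κ / 2) : modelSin κ x ≤ modelSin κ y := by
  unfold modelSin
  split_ifs with h1 h2
  · have hk : 0 < √κ := Real.sqrt_pos.mpr h1
    have h3 : √κ * y ≤ Real.pi / 2 := by
      calc √κ * y ≤ √κ * (Real.pi / √κ / 2) := by gcongr; exact h h1
        _ = Real.pi / 2 := by field_simp
    gcongr
    have h4 : √κ * x ≤ √κ * y := by gcongr
    have : 0 ≤ √κ * x := by positivity
    exact Real.sin_le_sin_of_le_of_le_pi_div_two (by linarith [Real.pi_pos]) h3 h4
  · have hk : 0 < √(-κ) := Real.sqrt_pos.mpr (by linarith)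
    gcongr
    exact Real.sinh_le_sinh.mpr (by gcongr)
  · exact hxy

/-- The derivative at `0` is `1`, so near `0` the error is at most `(1 - 1/l) x`. This gives `x / l`
as a lower bound, and `l x` as an upper bound because `1 - 1/l ≤ l - 1`. -/
lemma exists_modelSin_bounds (κ : ℝ) {l : ℝ} (hl : 1 < l) :
    ∃ ρ > 0, LtModelDiam κ ρ ∧ ∀ x, 0 ≤ x → x ≤ ρ → x ≤ l * modelSin κ x ∧ modelSin κ x ≤ l * x := by
  have h0 := (hasDerivAt_modelSin_zero κ).isLittleO
  have hc : 0 < 1 - 1 / l := by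
    have : 1 / l < 1 := by rw [div_lt_one (by linarith)]; exact hl
    linarith
  have h1 := h0.def hc
  rw [Metric.eventually_nhds_iff] at h1
  obtain ⟨ε, hε, h1⟩ := h1
  obtain ⟨ρ0, hρ0, hρ1⟩ : ∃ ρ0 > 0, LtModelDiam κ ρ0 := by
    by_cases hκ : 0 < κ
    · have : 0 < Real.pi / √κ := by have := Real.sqrt_pos.mpr hκ; positivity
      exact ⟨Real.pi / √κ / 2, by linarith, fun _ => by linarith⟩
    · exact ⟨1, one_pos, fun h => absurd h hκ⟩
  refine ⟨min ρ0 (ε / 2), by positivity, fun hk => (min_le_left _ _).trans_lt (hρ1 hk),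
    fun x hx hxρ => ?_⟩
  have hx2 : dist x 0 < ε := by
    rw [Real.dist_eq, sub_zero, abs_of_nonneg hx]
    linarith [hxρ.trans (min_le_right _ _)]
  have h2 := h1 hx2
  simp only [modelSin_zero, sub_zero, smul_eq_mul, mul_one, Real.norm_eq_abs, abs_of_nonneg hx] at h2
  obtain ⟨h3, h4⟩ := abs_le.mp h2
  have hl0 : 0 < l := by linarith
  have h5 : x / l ≤ modelSin κ x := by
    have : (1 - 1 / l) * x = x - x / l := by ring
    linarith
  constructor
  · rw [div_le_iff₀ hl0] at h5
    linarith
  · have h6 : 1 - 1 / l ≤ l - 1 := by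
      have : 1 - 1 / l = (l - 1) / l := by field_simp
      rw [this, div_le_iff₀ hl0]
      nlinarith
    nlinarith

lemma cos_sub_cos_half (m x : ℝ) :
    2 * Real.sin ((m + x) / 2) * Real.sin ((m - x) / 2) = Real.cos x - Real.cos m := by
  rw [Real.cos_sub_cos, show (x - m) / 2 = -((m - x) / 2) by ring, Real.sin_neg, add_comm x m]
  ring

/-- The law of cosines in the model plane, in half-angle form. -/
lemma modelSide_law {κ a b : ℝ} (θ : ℝ) (ha : 0 ≤ a) (hb : 0 ≤ b)
    (hka : 0 < κ → a ≤ Real.pi / √κ) (hkb : 0 < κ → b ≤ Real.pi / √κ) :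
    |a - b| ≤ modelSide κ a b θ ∧ (0 < κ → modelSide κ a b θ ≤ Real.pi / √κ) ∧
    2 * modelSin κ ((modelSide κ a b θ + (a - b)) / 2)
        * modelSin κ ((modelSide κ a b θ - (a - b)) / 2)
      = modelSin κ a * modelSin κ b * (1 - Real.cos θ) := by
  have hc1 := Real.cos_le_one θ
  have hc2 := Real.neg_one_le_cos θ
  rcases lt_trichotomy κ 0 with h | h | h
  · set k := √(-κ) with hkdef
    have hk : 0 < k := Real.sqrt_pos.mpr (by linarith)
    set X := Real.cosh (k * a) * Real.cosh (k * b)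
      - Real.sinh (k * a) * Real.sinh (k * b) * Real.cos θ with hX
    have hm : modelSide κ a b θ = Real.arcosh X / k := by
      simp only [modelSide, h.le.not_gt, h, if_false, if_true, hX, ← hkdef]
    have hsn : ∀ x, modelSin κ x = Real.sinh (k * x) / k := fun x => by
      simp [modelSin, h, h.le.not_gt, hkdef]
    have hs : 0 ≤ Real.sinh (k * a) * Real.sinh (k * b) :=
      mul_nonneg (Real.sinh_nonneg_iff.mpr (by positivity)) (Real.sinh_nonneg_iff.mpr (by positivity))
    -- Comparing with the degenerate side `a - b` isolates `1 - cos θ`; the difference of the two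
    -- hyperbolic cosines then factors through half-sum and half-difference. The spherical case runs
    -- in the same way.
    have hX2 : X = Real.cosh (k * (a - b))
        + Real.sinh (k * a) * Real.sinh (k * b) * (1 - Real.cos θ) := by
      rw [hX, mul_sub k, Real.cosh_sub]; ring
    have hX3 : Real.cosh (k * (a - b)) ≤ X := by
      rw [hX2]; nlinarith
    have hX1 : 1 ≤ X := (Real.one_le_cosh _).trans hX3
    have hkm : k * modelSide κ a b θ = Real.arcosh X := by rw [hm]; field_simp
    refine ⟨?_, fun h' => absurd h' h.le.not_gt, ?_⟩
    · rw [hm, le_div_iff₀ hk]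
      have e1 : |a - b| * k = |k * (a - b)| := by rw [abs_mul, abs_of_pos hk, mul_comm]
      rw [e1, ← Real.arcosh_cosh (abs_nonneg _), Real.cosh_abs]
      exact (Real.arcosh_le_arcosh (Real.cosh_pos _) (by linarith)).mpr hX3
    · simp only [hsn]
      have h3 : 2 * Real.sinh (k * ((modelSide κ a b θ + (a - b)) / 2))
          * Real.sinh (k * ((modelSide κ a b θ - (a - b)) / 2)) = X - Real.cosh (k * (a - b)) := by
        rw [← Real.cosh_arcosh hX1, ← hkm]
        set u := k * ((modelSide κ a b θ + (a - b)) / 2)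
        set v := k * ((modelSide κ a b θ - (a - b)) / 2)
        rw [show k * modelSide κ a b θ = u + v by simp only [u, v]; ring,
          show k * (a - b) = u - v by simp only [u, v]; ring, Real.cosh_add, Real.cosh_sub]
        ring
      have h4 : ∀ S T : ℝ, 2 * (S / k) * (T / k) = 2 * S * T / k ^ 2 := fun S T => by field_simp
      rw [h4, h3, hX2]
      field_simp
      ring
  · subst h
    have hm : modelSide 0 a b θ = √(a ^ 2 + b ^ 2 - 2 * a * b * Real.cos θ) := by
      simp [modelSide]
    have hsn : ∀ x, modelSin 0 x = x := fun x => by simp [modelSin]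
    have hab := mul_nonneg ha hb
    have h1 : (a - b) ^ 2 ≤ a ^ 2 + b ^ 2 - 2 * a * b * Real.cos θ := by nlinarith
    have hsq := Real.sq_sqrt ((sq_nonneg _).trans h1)
    refine ⟨?_, fun h' => absurd h' (lt_irrefl _), ?_⟩
    · rw [hm]
      exact Real.abs_le_sqrt h1
    · simp only [hsn, hm]
      nlinarith
  · set k := √κ with hkdef
    have hk : 0 < k := Real.sqrt_pos.mpr h
    have hka' := hka h
    have hkb' := hkb h
    rw [le_div_iff₀ hk] at hka' hkb'
    set X := Real.cos (k * a) * Real.cos (k * b)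
      + Real.sin (k * a) * Real.sin (k * b) * Real.cos θ with hX
    have hm : modelSide κ a b θ = Real.arccos X / k := by
      simp only [modelSide, h, if_true, hX, ← hkdef]
    have hsn : ∀ x, modelSin κ x = Real.sin (k * x) / k := fun x => by
      simp [modelSin, h, hkdef]
    have hs : 0 ≤ Real.sin (k * a) * Real.sin (k * b) :=
      mul_nonneg (Real.sin_nonneg_of_nonneg_of_le_pi (by positivity) (by linarith))
        (Real.sin_nonneg_of_nonneg_of_le_pi (by positivity) (by linarith))
    have hX2 : X = Real.cos (k * (a - b))
        - Real.sin (k * a) * Real.sin (k * b) * (1 - Real.cos θ) := by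
      rw [hX, mul_sub k, Real.cos_sub]; ring
    have hX3 : X ≤ Real.cos (k * (a - b)) := by
      rw [hX2]; nlinarith
    have hX1 : X ≤ 1 := hX3.trans (Real.cos_le_one _)
    have hX0 : -1 ≤ X := by
      have : Real.cos (k * (a + b)) ≤ X := by
        rw [hX, mul_add k, Real.cos_add]; nlinarith
      linarith [Real.neg_one_le_cos (k * (a + b))]
    have hkm : k * modelSide κ a b θ = Real.arccos X := by rw [hm]; field_simp
    refine ⟨?_, fun _ => ?_, ?_⟩
    · rw [hm, le_div_iff₀ hk]
      have e1 : |a - b| * k = |k * (a - b)| := by rw [abs_mul, abs_of_pos hk, mul_comm]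
      have e2 : |k * (a - b)| ≤ Real.pi := by
        rw [abs_le]; constructor <;> nlinarith
      rw [e1, ← Real.arccos_cos (abs_nonneg _) e2, Real.cos_abs]
      exact Real.arccos_le_arccos hX3
    · rw [hm]
      gcongr
      exact Real.arccos_le_pi _
    · simp only [hsn]
      have h3 := cos_sub_cos_half (k * modelSide κ a b θ) (k * (a - b))
      rw [hkm, Real.cos_arccos hX0 hX1, ← hkm, hX2] at h3
      rw [show k * ((modelSide κ a b θ + (a - b)) / 2)
          = (k * modelSide κ a b θ + k * (a - b)) / 2 by ring,
        show k * ((modelSide κ a b θ - (a - b)) / 2)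
          = (k * modelSide κ a b θ - k * (a - b)) / 2 by ring]
      have h4 : ∀ S T : ℝ, 2 * (S / k) * (T / k) = 2 * S * T / k ^ 2 := fun S T => by field_simp
      rw [h4, h3]
      field_simp
      ring

/-- By the addition formula, `a + b` is the side at `θ = π`, the largest one. For `κ > 0` the bound
on `a + b` keeps it in the range of `arccos`. -/
lemma modelSide_le_add {κ a b : ℝ} (θ : ℝ) (ha : 0 ≤ a) (hb : 0 ≤ b)
    (hk : 0 < κ → a + b ≤ Real.pi / √κ) : modelSide κ a b θ ≤ a + b := by
  have hc1 := Real.cos_le_one θ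
  have hc2 := Real.neg_one_le_cos θ
  unfold modelSide
  split_ifs with h1 h2
  · set k := √κ
    have hk0 : 0 < k := Real.sqrt_pos.mpr h1
    have hk' := hk h1
    rw [le_div_iff₀ hk0] at hk'
    have hs : 0 ≤ Real.sin (k * a) * Real.sin (k * b) :=
      mul_nonneg (Real.sin_nonneg_of_nonneg_of_le_pi (by positivity) (by nlinarith))
        (Real.sin_nonneg_of_nonneg_of_le_pi (by positivity) (by nlinarith))
    rw [div_le_iff₀ hk0, ← Real.arccos_cos (show 0 ≤ (a + b) * k by positivity) hk']
    refine Real.arccos_le_arccos ?_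
    rw [add_mul, Real.cos_add, mul_comm a, mul_comm b]
    nlinarith
  · set k := √(-κ)
    have hk0 : 0 < k := Real.sqrt_pos.mpr (by linarith)
    have hs : 0 ≤ Real.sinh (k * a) * Real.sinh (k * b) :=
      mul_nonneg (Real.sinh_nonneg_iff.mpr (by positivity)) (Real.sinh_nonneg_iff.mpr (by positivity))
    rw [div_le_iff₀ hk0, ← Real.arcosh_cosh (show 0 ≤ (a + b) * k by positivity)]
    refine (Real.arcosh_le_arcosh ?_ (Real.cosh_pos _)).mpr ?_
    · have : Real.cosh (k * (a - b)) ≤ Real.cosh (k * a) * Real.cosh (k * b)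
          - Real.sinh (k * a) * Real.sinh (k * b) * Real.cos θ := by
        rw [mul_sub, Real.cosh_sub]; nlinarith
      linarith [Real.cosh_pos (k * (a - b))]
    · rw [add_mul, Real.cosh_add, mul_comm a, mul_comm b]
      nlinarith
  · have hab := mul_nonneg ha hb
    exact Real.sqrt_le_iff.mpr ⟨by positivity, by nlinarith⟩

/-- Existence of comparison triangles, which supplies the `θ` in `IsCAT.comparison`. It is the
intermediate value theorem in `θ` for the cosine, hyperbolic cosine or square of the side: the
triangle inequalities place `d` between the values at `0` and `π`. -/
lemma exists_modelSide_eq {κ a b d : ℝ} (ha : 0 ≤ a) (hb : 0 ≤ b) (h1 : |a - b| ≤ d)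
    (h2 : d ≤ a + b) (h3 : 0 < κ → a + b + d ≤ 2 * (Real.pi / √κ)) :
    ∃ θ ∈ Icc 0 Real.pi, d = modelSide κ a b θ := by
  have hd : 0 ≤ d := (abs_nonneg _).trans h1
  unfold modelSide
  split_ifs with hκ hκ'
  · set k := √κ
    have hk : 0 < k := Real.sqrt_pos.mpr hκ
    have h3' := h3 hκ
    rw [← mul_div_assoc, le_div_iff₀ hk] at h3'
    have hcont : ContinuousOn (fun θ : ℝ => Real.cos (k * a) * Real.cos (k * b)
      + Real.sin (k * a) * Real.sin (k * b) * Real.cos θ) (Icc 0 Real.pi) := by fun_prop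
    have hdk : d * k ≤ Real.pi := by nlinarith
    obtain ⟨θ, hθ, h⟩ : Real.cos (d * k) ∈ (fun θ : ℝ => Real.cos (k * a) * Real.cos (k * b)
      + Real.sin (k * a) * Real.sin (k * b) * Real.cos θ) '' (Icc 0 Real.pi) := by
      refine intermediate_value_Icc' Real.pi_pos.le hcont ⟨?_, ?_⟩
      · simp only [Real.cos_pi]
        have : Real.cos ((a + b) * k) ≤ Real.cos (d * k) := by
          by_cases hab : (a + b) * k ≤ Real.pi
          · exact Real.cos_le_cos_of_nonneg_of_le_pi (by positivity) hab (by gcongr)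
          -- Past the half circle, `a + b` is replaced by its reflection `2π - (a + b) k`, and the
          -- perimeter bound says exactly that `d k` stays below it.
          · rw [← Real.cos_two_pi_sub ((a + b) * k)]
            exact Real.cos_le_cos_of_nonneg_of_le_pi (by positivity) (by linarith) (by linarith)
        rw [add_mul, Real.cos_add, mul_comm a, mul_comm b] at this
        linarith
      · simp only [Real.cos_zero]
        have : Real.cos (d * k) ≤ Real.cos ((a - b) * k) := by
          rw [← Real.cos_abs ((a - b) * k), abs_mul, abs_of_pos hk]
          exact Real.cos_le_cos_of_nonneg_of_le_pi (by positivity) hdk (by gcongr)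
        rw [sub_mul, Real.cos_sub, mul_comm a, mul_comm b] at this
        linarith
    refine ⟨θ, hθ, ?_⟩
    simp only at h
    rw [h, Real.arccos_cos (by positivity) hdk]
    field_simp
  · set k := √(-κ)
    have hk : 0 < k := Real.sqrt_pos.mpr (by linarith)
    have hcont : ContinuousOn (fun θ : ℝ => Real.cosh (k * a) * Real.cosh (k * b)
      - Real.sinh (k * a) * Real.sinh (k * b) * Real.cos θ) (Icc 0 Real.pi) := by fun_prop
    obtain ⟨θ, hθ, h⟩ : Real.cosh (d * k) ∈ (fun θ : ℝ => Real.cosh (k * a) * Real.cosh (k * b)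
      - Real.sinh (k * a) * Real.sinh (k * b) * Real.cos θ) '' (Icc 0 Real.pi) := by
      refine intermediate_value_Icc Real.pi_pos.le hcont ⟨?_, ?_⟩
      · simp only [Real.cos_zero]
        have : Real.cosh ((a - b) * k) ≤ Real.cosh (d * k) := by
          rw [Real.cosh_le_cosh, abs_mul, abs_mul, abs_of_nonneg hd]
          gcongr
        rw [sub_mul, Real.cosh_sub, mul_comm a, mul_comm b] at this
        linarith
      · simp only [Real.cos_pi]
        have : Real.cosh (d * k) ≤ Real.cosh ((a + b) * k) := by
          rw [Real.cosh_le_cosh, abs_mul, abs_mul, abs_of_nonneg hd, abs_of_nonneg (add_nonneg ha hb)]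
          gcongr
        rw [add_mul, Real.cosh_add, mul_comm a, mul_comm b] at this
        linarith
    refine ⟨θ, hθ, ?_⟩
    simp only at h
    rw [h, Real.arcosh_cosh (by positivity)]
    field_simp
  · have hcont : ContinuousOn (fun θ : ℝ => a ^ 2 + b ^ 2 - 2 * a * b * Real.cos θ)
      (Icc 0 Real.pi) := by fun_prop
    have h1' := sq_le_sq' (by linarith [abs_nonneg (a - b)]) h1
    rw [sq_abs] at h1'
    obtain ⟨θ, hθ, h⟩ : d ^ 2 ∈ (fun θ : ℝ => a ^ 2 + b ^ 2 - 2 * a * b * Real.cos θ)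
      '' (Icc 0 Real.pi) := by
      refine intermediate_value_Icc Real.pi_pos.le hcont ⟨?_, ?_⟩
      · simp only [Real.cos_zero]; linarith
      · simp only [Real.cos_pi]; nlinarith
    refine ⟨θ, hθ, ?_⟩
    simp only at h
    rw [h, Real.sqrt_sq hd]

/-- In small triangles, the law of cosines of the model plane agrees with the Euclidean one up to a
factor close to one. -/
lemma exists_modelSide_bounds (κ : ℝ) {l : ℝ} (hl : 1 < l) :
    ∃ ρ > 0, LtModelDiam κ (2 * ρ) ∧ ∀ a b θ, 0 ≤ a → a ≤ ρ → 0 ≤ b → b ≤ ρ →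
      modelSide κ a b θ ^ 2 - (a - b) ^ 2 ≤ l * (2 * a * b * (1 - Real.cos θ)) ∧
      2 * a * b * (1 - Real.cos θ) ≤ l * (modelSide κ a b θ ^ 2 - (a - b) ^ 2) := by
  -- Each estimate replaces four model sines by their arguments (two sides, half-sum,
  -- half-difference), at the cost of a factor `e` each.
  set e := √√l with he
  have hl1 : 1 < √l := Real.lt_sqrt_of_sq_lt (by simpa)
  have he1 : 1 < e := Real.lt_sqrt_of_sq_lt (by simpa)
  have hel : e ^ 4 = l := by
    rw [show e ^ 4 = (e ^ 2) ^ 2 by ring, he, Real.sq_sqrt (by linarith), Real.sq_sqrt (by linarith)]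
  obtain ⟨ρ, hρ, hρD, hb⟩ := exists_modelSin_bounds κ he1
  refine ⟨ρ / 2, by positivity, by rwa [mul_div_cancel₀ _ (two_ne_zero)], ?_⟩
  intro a b θ ha haρ hb0 hbρ
  obtain ⟨h1, -, h3⟩ := modelSide_law (κ := κ) θ ha hb0
    (fun h => by linarith [hρD h]) (fun h => by linarith [hρD h])
  have h2 := modelSide_le_add (κ := κ) θ ha hb0 (fun h => by linarith [hρD h])
  set m := modelSide κ a b θ
  obtain ⟨h4, h5⟩ := abs_le.mp h1
  set u := (m + (a - b)) / 2 with hu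
  set v := (m - (a - b)) / 2 with hv
  have hu0 : 0 ≤ u := by rw [hu]; linarith
  have hv0 : 0 ≤ v := by rw [hv]; linarith
  have huv : m ^ 2 - (a - b) ^ 2 = 4 * (u * v) := by rw [hu, hv]; ring
  obtain ⟨u1, u2⟩ := hb u hu0 (by rw [hu]; linarith)
  obtain ⟨v1, v2⟩ := hb v hv0 (by rw [hv]; linarith)
  obtain ⟨a1, a2⟩ := hb a ha (by linarith)
  obtain ⟨b1, b2⟩ := hb b hb0 (by linarith)
  have nn : ∀ x, 0 ≤ x → x ≤ e * modelSin κ x → 0 ≤ modelSin κ x := fun x hx h => by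
    by_contra! hc; nlinarith
  have su := nn _ hu0 u1
  have sv := nn _ hv0 v1
  have sa := nn _ ha a1
  have sb := nn _ hb0 b1
  have hc : 0 ≤ 1 - Real.cos θ := by linarith [Real.cos_le_one θ]
  rw [huv, ← hel]
  constructor
  · calc 4 * (u * v) ≤ 4 * ((e * modelSin κ u) * (e * modelSin κ v)) := by gcongr
      _ = 2 * e ^ 2 * (2 * modelSin κ u * modelSin κ v) := by ring
      _ = 2 * e ^ 2 * (modelSin κ a * modelSin κ b * (1 - Real.cos θ)) := by rw [h3]
      _ ≤ 2 * e ^ 2 * ((e * a) * (e * b) * (1 - Real.cos θ)) := by gcongr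
      _ = _ := by ring
  · calc 2 * a * b * (1 - Real.cos θ)
        ≤ 2 * (e * modelSin κ a) * (e * modelSin κ b) * (1 - Real.cos θ) := by gcongr
      _ = 2 * e ^ 2 * (modelSin κ a * modelSin κ b * (1 - Real.cos θ)) := by ring
      _ = 2 * e ^ 2 * (2 * modelSin κ u * modelSin κ v) := by rw [h3]
      _ ≤ 2 * e ^ 2 * (2 * (e * u) * (e * v)) := by gcongr
      _ = _ := by ring

/-! ### Shortest paths -/

section ShortestPaths

variable {M : Type*} [MetricSpace M] {p q : M} {c : ℝ → M}

lemma IsShortestPath.reverse (h : IsShortestPath p q c) :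
    IsShortestPath q p fun s => c (dist p q - s) where
  start := by simpa using h.finish
  finish := by rw [dist_comm q p, sub_self]; exact h.start
  isometric s hs t ht := by
    rw [dist_comm q p] at hs ht
    rw [h.isometric _ ⟨by linarith [hs.2], by linarith [hs.1]⟩ _
      ⟨by linarith [ht.2], by linarith [ht.1]⟩, abs_sub_comm]
    congr 1
    ring

lemma IsShortestPath.dist_left (h : IsShortestPath p q c) {s : ℝ} (hs : s ∈ Icc 0 (dist p q)) :
    dist p (c s) = s := by
  have := h.isometric 0 ⟨le_rfl, dist_nonneg⟩ s hs
  rwa [h.start, zero_sub, abs_neg, abs_of_nonneg hs.1] at this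

lemma IsShortestPath.dist_right (h : IsShortestPath p q c) {s : ℝ} (hs : s ∈ Icc 0 (dist p q)) :
    dist (c s) q = dist p q - s := by
  have := h.isometric s hs _ ⟨dist_nonneg, le_rfl⟩
  rwa [h.finish, abs_sub_comm, abs_of_nonneg (by linarith [hs.2])] at this

lemma IsShortestPath.restrict (h : IsShortestPath p q c) {s : ℝ} (hs : s ∈ Icc 0 (dist p q)) :
    IsShortestPath p (c s) c where
  start := h.start
  finish := by rw [h.dist_left hs]
  isometric u hu v hv := by
    rw [h.dist_left hs] at hu hv
    exact h.isometric u ⟨hu.1, hu.2.trans hs.2⟩ v ⟨hv.1, hv.2.trans hs.2⟩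

lemma GeodesicFrom.dist_left (γ : GeodesicFrom p) {s : ℝ} (hs : s ∈ Ico 0 γ.length) :
    dist p (γ.toFun s) = s := by
  have := γ.isometric 0 ⟨le_rfl, γ.length_pos⟩ s hs
  rwa [γ.start, zero_sub, abs_neg, abs_of_nonneg hs.1] at this

lemma GeodesicFrom.isShortestPath (γ : GeodesicFrom p) {s : ℝ} (hs : s ∈ Ico 0 γ.length) :
    IsShortestPath p (γ.toFun s) γ.toFun where
  start := γ.start
  finish := by rw [γ.dist_left hs]
  isometric u hu v hv := by
    rw [γ.dist_left hs] at hu hv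
    exact γ.isometric u ⟨hu.1, hu.2.trans_lt hs.2⟩ v ⟨hv.1, hv.2.trans_lt hs.2⟩

lemma sq_sub_le_sq_dist (p q r : M) : (dist p q - dist p r) ^ 2 ≤ dist q r ^ 2 := by
  have h := abs_dist_sub_le q r p
  rw [dist_comm q p, dist_comm r p] at h
  rw [← sq_abs (dist p q - dist p r)]
  gcongr

end ShortestPaths

/-! ### Almost Euclidean comparison at small scales -/

section Comparison

variable {M : Type*} [MetricSpace M] {κ : ℝ}

/-- Two shortest paths of length at most `ρ` with a common starting point spread at least as fast as
in the Euclidean plane, up to the factor `l`. -/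
def AlmostFlat (M : Type*) [MetricSpace M] (l ρ : ℝ) : Prop :=
  ∀ (p q r : M) (c e : ℝ → M), IsShortestPath p q c → IsShortestPath p r e →
    dist p q ≤ ρ → dist p r ≤ ρ → ∀ s ∈ Icc 0 (dist p q), ∀ t ∈ Icc 0 (dist p r),
    (dist (c s) (e t) ^ 2 - (s - t) ^ 2) * (dist p q * dist p r)
      ≤ l * (s * t) * (dist q r ^ 2 - (dist p q - dist p r) ^ 2)

/-- The comparison triangle has the same `θ` at both scales, so both sides are compared with `1 -
cos θ`; each passage between model and Euclidean law of cosines costs `√l`. -/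
lemma IsCAT.exists_almostFlat (hM : IsCAT κ M) {l : ℝ} (hl : 1 < l) :
    ∃ ρ > 0, LtModelDiam κ ρ ∧ AlmostFlat M l ρ := by
  have hl1 : 1 < √l := Real.lt_sqrt_of_sq_lt (by simpa)
  have hll : √l * √l = l := Real.mul_self_sqrt (by linarith)
  obtain ⟨ρ, hρ, hρD, h⟩ := exists_modelSide_bounds κ hl1
  refine ⟨ρ, hρ, fun hk => by linarith [hρD hk], ?_⟩
  intro p q r c e hc he hq hr s hs t ht
  have hD : LtModelDiam κ ((dist p q + dist q r + dist r p) / 2) := fun hk => by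
    have := dist_triangle_left q r p
    rw [dist_comm r p]
    linarith [hρD hk]
  have hqr : |dist p q - dist p r| ≤ dist q r := by
    have := abs_dist_sub_le q r p
    rwa [dist_comm q p, dist_comm r p] at this
  obtain ⟨θ, hθ, hθd⟩ := exists_modelSide_eq (κ := κ) dist_nonneg dist_nonneg hqr
    (dist_triangle_left q r p) (fun hk => by
      have := hD hk
      rw [dist_comm r p] at this
      linarith)
  have hcmp := hM.comparison p q r hD c e hc he θ hθ hθd s hs t ht
  have h1 := (h s t θ hs.1 (hs.2.trans hq) ht.1 (ht.2.trans hr)).1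
  have h2 := (h _ _ θ dist_nonneg hq dist_nonneg hr).2
  rw [← hθd] at h2
  have h3 : dist (c s) (e t) ^ 2 ≤ modelSide κ s t θ ^ 2 := by gcongr
  have hst : 0 ≤ s * t := mul_nonneg hs.1 ht.1
  have hab : 0 ≤ dist p q * dist p r := by positivity
  calc (dist (c s) (e t) ^ 2 - (s - t) ^ 2) * (dist p q * dist p r)
      ≤ (√l * (2 * s * t * (1 - Real.cos θ))) * (dist p q * dist p r) := by
        gcongr
        linarith
    _ = √l * (s * t) * (2 * dist p q * dist p r * (1 - Real.cos θ)) := by ring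
    _ ≤ √l * (s * t) * (√l * (dist q r ^ 2 - (dist p q - dist p r) ^ 2)) := by gcongr
    _ = (√l * √l) * (s * t) * (dist q r ^ 2 - (dist p q - dist p r) ^ 2) := by ring
    _ = _ := by rw [hll]

/-- The angle is bounded by the comparison angles, up to a factor. -/
lemma AlmostFlat.angle_le {l ρ : ℝ} (h : AlmostFlat M l ρ) (hl : 0 ≤ l) {p : M}
    (γ η : GeodesicFrom p) {a b : ℝ} (ha : 0 < a) (hb : 0 < b) (haρ : a ≤ ρ) (hbρ : b ≤ ρ)
    (hda : dist p (γ.toFun a) = a) (hdb : dist p (η.toFun b) = b)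
    (hγ : IsShortestPath p (γ.toFun a) γ.toFun) (hη : IsShortestPath p (η.toFun b) η.toFun) :
    2 * a * b * (1 - Real.cos (γ.angle η))
      ≤ l * (dist (γ.toFun a) (η.toFun b) ^ 2 - (a - b) ^ 2) := by
  set Q := dist (γ.toFun a) (η.toFun b) ^ 2 - (a - b) ^ 2 with hQ
  have hQ0 : 0 ≤ Q := by
    have := sq_sub_le_sq_dist p (γ.toFun a) (η.toFun b)
    rw [hda, hdb] at this
    linarith
  -- By `AlmostFlat`, `y` bounds from below the cosine expression inside `compAngle` at all smaller
  -- scales.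
  set y := 1 - l * Q / (2 * a * b) with hy
  have hy1 : y ≤ 1 := by
    have : 0 ≤ l * Q / (2 * a * b) := by positivity
    linarith
  have hA : γ.angle η ≤ Real.arccos y := by
    refine limsup_le_of_le (GeodesicFrom.isCoboundedUnder_compAngle γ η _) ?_
    have e1 : ∀ᶠ s : ℝ in 𝓝[>] 0, s ∈ Ioc 0 a := Ioc_mem_nhdsGT ha
    have e2 : ∀ᶠ s : ℝ in 𝓝[>] 0, s ∈ Ioc 0 b := Ioc_mem_nhdsGT hb
    filter_upwards [e1.prod_mk e2] with ⟨s, t⟩ ⟨hs, ht⟩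
    refine Real.arccos_le_arccos ?_
    have hs0 : 0 < s := hs.1
    have ht0 : 0 < t := ht.1
    have := h p _ _ _ _ hγ hη (by rwa [hda]) (by rwa [hdb]) s (by rw [hda]; exact ⟨hs.1.le, hs.2⟩)
      t (by rw [hdb]; exact ⟨ht.1.le, ht.2⟩)
    rw [hda, hdb, ← hQ] at this
    rw [le_div_iff₀ (by positivity), hy]
    have h2 : (dist (γ.toFun s) (η.toFun t) ^ 2 - (s - t) ^ 2) ≤ l * (s * t) * Q / (a * b) := by
      rw [le_div_iff₀ (by positivity)]
      exact this
    have h3 : (1 - l * Q / (2 * a * b)) * (2 * s * t) = 2 * s * t - l * (s * t) * Q / (a * b) := by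
      field_simp
    simp only
    rw [h3]
    linarith
  have hcos : y ≤ Real.cos (γ.angle η) := by
    -- `arccos` truncates below `-1`, but there the bound on the cosine is trivial.
    by_cases hy0 : -1 ≤ y
    · rw [← Real.cos_arccos hy0 hy1]
      exact Real.cos_le_cos_of_nonneg_of_le_pi (GeodesicFrom.angle_nonneg _ _)
        (Real.arccos_le_pi _) hA
    · linarith [Real.neg_one_le_cos (γ.angle η)]
  have : 1 - Real.cos (γ.angle η) ≤ l * Q / (2 * a * b) := by linarith
  rw [le_div_iff₀ (by positivity)] at this
  linarith

/-- In a CAT(κ) space, the angle between two geodesics exists as a limit. -/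
lemma IsCAT.tendsto_comparison (hM : IsCAT κ M) {p : M} (γ η : GeodesicFrom p) :
    Tendsto (fun x : ℝ × ℝ => (dist (γ.toFun x.1) (η.toFun x.2) ^ 2 - (x.1 - x.2) ^ 2)
      / (2 * x.1 * x.2)) (𝓝[>] (0 : ℝ) ×ˢ 𝓝[>] (0 : ℝ)) (𝓝 (1 - Real.cos (γ.angle η))) := by
  have e1 : ∀ᶠ s : ℝ in 𝓝[>] 0, s ∈ Ioo 0 γ.length := Ioo_mem_nhdsGT γ.length_pos
  have e2 : ∀ᶠ s : ℝ in 𝓝[>] 0, s ∈ Ioo 0 η.length := Ioo_mem_nhdsGT η.length_pos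
  rw [tendsto_order]
  constructor
  -- Lower bound: the angle is at most every small comparison angle up to the factor `l`, and `l` is
  -- taken close to `1`.
  · intro w hw
    obtain ⟨l, hl1, hlw⟩ : ∃ l : ℝ, 1 < l ∧ w < (1 - Real.cos (γ.angle η)) / l := by
      have hc : ContinuousAt (fun l : ℝ => (1 - Real.cos (γ.angle η)) / l) 1 :=
        continuousAt_const.div continuousAt_id one_ne_zero
      have : ∀ᶠ l in 𝓝[>] (1 : ℝ), w < (1 - Real.cos (γ.angle η)) / l :=
        (hc.tendsto.mono_left nhdsWithin_le_nhds).eventually (lt_mem_nhds (by simpa using hw))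
      obtain ⟨l, h1, h2⟩ := (this.and self_mem_nhdsWithin).exists
      exact ⟨l, h2, h1⟩
    obtain ⟨ρ, hρ, -, hf⟩ := hM.exists_almostFlat hl1
    have e3 : ∀ᶠ s : ℝ in 𝓝[>] 0, s ∈ Ioo 0 ρ := Ioo_mem_nhdsGT hρ
    filter_upwards [(e1.and e3).prod_mk (e2.and e3)] with ⟨s, t⟩ ⟨⟨hs, hsρ⟩, ⟨ht, htρ⟩⟩
    simp only at hs hsρ ht htρ ⊢
    have hs' := Ioo_subset_Ico_self hs
    have ht' := Ioo_subset_Ico_self ht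
    have hs0 : 0 < s := hs.1
    have ht0 : 0 < t := ht.1
    have := hf.angle_le (by linarith) γ η hs.1 ht.1 hsρ.2.le htρ.2.le (γ.dist_left hs')
      (η.dist_left ht') (γ.isShortestPath hs') (η.isShortestPath ht')
    refine hlw.trans_le ?_
    rw [div_le_div_iff₀ (by linarith) (by positivity)]
    linarith
  -- Upper bound: the angle is by definition the upper limit of the comparison angles, and `cos` is
  -- continuous at it.
  · intro w hw
    have hc : ∀ᶠ θ in 𝓝 (γ.angle η), 1 - Real.cos θ < w :=
      (continuous_const.sub Real.continuous_cos).continuousAt.eventually (gt_mem_nhds hw)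
    obtain ⟨δ, hδ, hc⟩ := Metric.eventually_nhds_iff.mp hc
    have e3 : ∀ᶠ x : ℝ × ℝ in 𝓝[>] (0 : ℝ) ×ˢ 𝓝[>] (0 : ℝ),
        GeodesicFrom.compAngle γ η x.1 x.2 < γ.angle η + δ :=
      eventually_lt_of_limsup_lt (lt_add_of_pos_right _ hδ)
        (GeodesicFrom.isBoundedUnder_compAngle γ η _)
    filter_upwards [e1.prod_mk e2, e3] with ⟨s, t⟩ ⟨hs, ht⟩ h3
    simp only at hs ht h3 ⊢
    have hs' := Ioo_subset_Ico_self hs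
    have ht' := Ioo_subset_Ico_self ht
    have hs0 : 0 < s := hs.1
    have ht0 : 0 < t := ht.1
    have hd1 := sq_sub_le_sq_dist p (γ.toFun s) (η.toFun t)
    have hd2 := dist_triangle_left (γ.toFun s) (η.toFun t) p
    rw [γ.dist_left hs', η.dist_left ht'] at hd1 hd2
    have hd3 : dist (γ.toFun s) (η.toFun t) ^ 2 ≤ (s + t) ^ 2 := by gcongr
    have hcos : Real.cos (GeodesicFrom.compAngle γ η s t)
        = (s ^ 2 + t ^ 2 - dist (γ.toFun s) (η.toFun t) ^ 2) / (2 * s * t) := by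
      apply Real.cos_arccos
      · rw [le_div_iff₀ (by positivity)]; linarith
      · rw [div_le_one (by positivity)]; linarith
    have hK : (dist (γ.toFun s) (η.toFun t) ^ 2 - (s - t) ^ 2) / (2 * s * t)
        = 1 - Real.cos (GeodesicFrom.compAngle γ η s t) := by
      rw [hcos]; field_simp; ring
    rw [hK]
    rcases le_total (GeodesicFrom.compAngle γ η s t) (γ.angle η) with hle | hle
    · have := Real.cos_le_cos_of_nonneg_of_le_pi (Real.arccos_nonneg _)
        (GeodesicFrom.angle_le_pi γ η) hle
      have h' : Real.cos (γ.angle η) ≤ Real.cos (GeodesicFrom.compAngle γ η s t) := this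
      linarith
    · exact hc (by rw [Real.dist_eq, abs_of_nonneg (by linarith)]; linarith)

/-! ### The tangent cone -/

namespace TangentCone

variable {p : M}

lemma length_nonneg (V : TangentCone p) : 0 ≤ V.length := by
  cases V with
  | apex => exact le_rfl
  | ray V r hr => exact hr.le

lemma innerProd_comm (V W : TangentCone p) : innerProd V W = innerProd W V := by
  cases V <;> cases W <;> simp only [innerProd, Direction.angle_comm]
  rw [Direction.angle_comm]; ring

lemma abs_innerProd_le (V W : TangentCone p) : |innerProd V W| ≤ V.length * W.length := by
  cases V with
  | apex => simp [innerProd, length]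
  | ray V r hr => cases W with
    | apex => simp [innerProd, length]
    | ray W s hs =>
      simp only [innerProd, length]
      rw [abs_mul, abs_of_pos (mul_pos hr hs)]
      exact mul_le_of_le_one_right (by positivity) (Real.abs_cos_le_one _)

lemma dist_sq (V W : TangentCone p) :
    dist V W ^ 2 = V.length ^ 2 + W.length ^ 2 - 2 * innerProd V W := by
  refine Real.sq_sqrt ?_
  have := (abs_le.mp (abs_innerProd_le V W)).2
  nlinarith [sq_nonneg (V.length - W.length)]

lemma innerProd_apex_right (V : TangentCone p) : innerProd V apex = 0 := by
  cases V <;> rfl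

lemma dist_apex_left (V : TangentCone p) : dist apex V = V.length := coneDist_apex_left V

lemma dist_apex_right (V : TangentCone p) : dist V apex = V.length := by
  rw [dist_comm, dist_apex_left]

lemma length_scale {t : ℝ} (ht : 0 ≤ t) (V : TangentCone p) : (V.scale t).length = t * V.length := by
  cases V with
  | apex => simp [scale, length]
  | ray V r hr =>
    rcases ht.eq_or_lt with h | h
    · simp [scale, ← h, length]
    · simp [scale, h, length]

lemma innerProd_scale {t : ℝ} (ht : 0 ≤ t) (V W : TangentCone p) :
    innerProd (V.scale t) W = t * innerProd V W := by
  cases V with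
  | apex => simp [scale, innerProd]
  | ray V r hr =>
    rcases ht.eq_or_lt with h | h
    · simp [scale, ← h, innerProd]
    · cases W with
      | apex => simp [innerProd_apex_right]
      | ray W s hs =>
        simp only [scale, h, dif_pos, innerProd]
        ring

/-- Polarization with respect to the apex. Continuity is what makes the integrands of the derivative
formula measurable. -/
lemma continuous_innerProd (V : TangentCone p) :
    Continuous fun X : TangentCone p => V.innerProd X := by
  have : (fun X : TangentCone p => V.innerProd X)
      = fun X => (V.length ^ 2 + dist apex X ^ 2 - dist V X ^ 2) / 2 := by
    funext X
    rw [dist_sq V X, dist_apex_left]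
    ring
  rw [this]
  fun_prop

end TangentCone

/-! ### Blow-up of the metric and the CN inequality in the cone -/

lemma Direction.mk_out {p : M} (V : Direction p) : Direction.mk (Quotient.out V) = V :=
  Quotient.out_eq V

lemma eventually_mul_mem_Ioo {r L : ℝ} (hr : 0 < r) (hL : 0 < L) :
    ∀ᶠ t in 𝓝[>] (0 : ℝ), r * t ∈ Ioo 0 L := by
  filter_upwards [Ioo_mem_nhdsGT (div_pos hL hr)] with t ht
  exact ⟨mul_pos hr ht.1, by rw [mul_comm]; exact (lt_div_iff₀ hr).mp ht.2⟩

lemma tendsto_mul_nhdsGT_zero {r : ℝ} (hr : 0 < r) :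
    Tendsto (fun t : ℝ => r * t) (𝓝[>] 0) (𝓝[>] 0) := by
  refine tendsto_nhdsWithin_iff.mpr ⟨?_, ?_⟩
  · have : Tendsto (fun t : ℝ => r * t) (𝓝 0) (𝓝 (r * 0)) := (continuous_const_mul r).tendsto 0
    rw [mul_zero] at this
    exact this.mono_left nhdsWithin_le_nhds
  · filter_upwards [self_mem_nhdsWithin] with t ht using mul_pos hr ht

lemma expCurve_ray_dist {p : M} (V : Direction p) {r : ℝ} (hr : 0 < r) :
    ∀ᶠ t in 𝓝[>] (0 : ℝ), dist p (expCurve (TangentCone.ray V r hr) t) / t = r := by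
  filter_upwards [eventually_mul_mem_Ioo hr (Quotient.out V).length_pos, self_mem_nhdsWithin]
    with t ht ht0
  rw [expCurve, GeodesicFrom.dist_left _ (Ioo_subset_Ico_self ht)]
  exact mul_div_cancel_right₀ _ (ne_of_gt ht0)

/-- The conical metric is the blow-up of the metric of the space. -/
lemma IsCAT.tendsto_dist_expCurve (hM : IsCAT κ M) {p : M} (V W : TangentCone p) :
    Tendsto (fun t => dist (expCurve V t) (expCurve W t) / t) (𝓝[>] (0 : ℝ)) (𝓝 (dist V W)) := by
  cases V with
  | apex =>
    rw [TangentCone.dist_apex_left]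
    cases W with
    | apex => simp [expCurve, TangentCone.length]
    | ray W s hs => exact tendsto_const_nhds.congr' (EventuallyEq.symm (expCurve_ray_dist W hs))
  | ray V r hr =>
    cases W with
    | apex =>
      rw [TangentCone.dist_apex_right]
      refine tendsto_const_nhds.congr' (EventuallyEq.symm ?_)
      simp only [expCurve, dist_comm _ p]
      exact expCurve_ray_dist V hr
    | ray W s hs =>
      -- The origin is approached along the pairs `(r t, s t)`; after division by `t²` the Euclidean
      -- law of cosines becomes the one that defines the conical metric.
      have h1 := (hM.tendsto_comparison (Quotient.out V) (Quotient.out W)).comp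
        ((tendsto_mul_nhdsGT_zero hr).prodMk (tendsto_mul_nhdsGT_zero hs))
      have h2 := ((h1.const_mul (2 * r * s)).const_add ((r - s) ^ 2)).sqrt
      have h3 : dist (TangentCone.ray V r hr) (TangentCone.ray W s hs) = √((r - s) ^ 2
          + 2 * r * s * (1 - Real.cos ((Quotient.out V).angle (Quotient.out W)))) := by
        rw [← Direction.angle_mk, Direction.mk_out, Direction.mk_out]
        show TangentCone.coneDist _ _ = _
        rw [TangentCone.coneDist_ray, planeSide]
        congr 1
        ring
      rw [h3]
      refine h2.congr' ?_
      filter_upwards [self_mem_nhdsWithin] with t ht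
      have ht0 : 0 < t := ht
      simp only [Function.comp, expCurve]
      rw [← Real.sqrt_sq (div_nonneg (dist_nonneg (x := (Quotient.out V).toFun (r * t))
        (y := (Quotient.out W).toFun (s * t))) ht0.le)]
      congr 1
      field_simp
      ring

/-- An approximate form of the CN inequality of Bruhat and Tits. -/
lemma AlmostFlat.dist_sq_le {l ρ : ℝ} (h : AlmostFlat M l ρ) (hl : 1 ≤ l) {a b w : M} {c e : ℝ → M}
    (hc : IsShortestPath a b c) (he : IsShortestPath a w e) (hb : dist a b ≤ ρ) (hw : dist a w ≤ ρ)
    {τ : ℝ} (hτ : τ ∈ Icc (0 : ℝ) 1) :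
    dist w (c (τ * dist a b)) ^ 2 ≤ (1 - τ) * dist w a ^ 2 + τ * dist w b ^ 2
      - τ * (1 - τ) * dist a b ^ 2 + (l - 1) * dist w b ^ 2 := by
  have hτ0 := hτ.1
  have hτ1 := hτ.2
  have hmem : τ * dist a b ∈ Icc 0 (dist a b) :=
    ⟨by positivity, mul_le_of_le_one_left dist_nonneg hτ1⟩
  have hsub := sq_sub_le_sq_dist a w b
  -- The path to `w` is used in full and the path to `b` up to the fraction `τ`, so that `dist a w *
  -- dist a b` cancels. For `l = 1` the right side expands to the exact CN bound.
  have key : dist w (c (τ * dist a b)) ^ 2 ≤ (dist a w - τ * dist a b) ^ 2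
      + l * τ * (dist w b ^ 2 - (dist a w - dist a b) ^ 2) := by
    rcases eq_or_ne a w with rfl | haw
    · rw [hc.dist_left hmem, dist_self]
      apply le_of_eq
      ring
    rcases eq_or_ne a b with rfl | hab
    · rw [dist_self, mul_zero, hc.start, dist_comm w a]
      apply le_of_eq
      ring
    have h1 := h a w b e c he hc hw hb _ ⟨dist_nonneg, le_rfl⟩ _ hmem
    rw [he.finish] at h1
    have hpos : 0 < dist a w * dist a b := mul_pos (dist_pos.mpr haw) (dist_pos.mpr hab)
    have h2 : (dist w (c (τ * dist a b)) ^ 2 - (dist a w - τ * dist a b) ^ 2)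
        * (dist a w * dist a b) ≤ (l * τ * (dist w b ^ 2 - (dist a w - dist a b) ^ 2))
        * (dist a w * dist a b) := by
      refine h1.trans (le_of_eq ?_)
      ring
    linarith [le_of_mul_le_mul_right h2 hpos]
  have h3 : (l - 1) * τ * (dist w b ^ 2 - (dist a w - dist a b) ^ 2) ≤ (l - 1) * dist w b ^ 2 := by
    have : τ * (dist w b ^ 2 - (dist a w - dist a b) ^ 2) ≤ dist w b ^ 2 := by
      nlinarith [sq_nonneg (dist a w - dist a b)]
    nlinarith
  rw [dist_comm w a]
  nlinarith

/-- The CN inequality in the tangent cone. -/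
lemma IsCAT.cone_dist_sq_le (hM : IsCAT κ M) {p : M} {U V Z : TangentCone p} (W : TangentCone p)
    {τ : ℝ} (hτ : τ ∈ Icc (0 : ℝ) 1) (hU : dist U Z = τ * dist U V)
    (hV : dist Z V = (1 - τ) * dist U V) :
    dist W Z ^ 2 ≤ (1 - τ) * dist W U ^ 2 + τ * dist W V ^ 2 - τ * (1 - τ) * dist U V ^ 2 := by
  set B : ℝ := (1 - τ) * dist W U ^ 2 + τ * dist W V ^ 2 - τ * (1 - τ) * dist U V ^ 2 with hB
  -- The second root measures how far `Z` may be from the blow-up of actual points on geodesics of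
  -- `M`; it vanishes as `l → 1`.
  have main : ∀ l : ℝ, 1 < l →
      dist W Z ≤ √(B + (l - 1) * dist W V ^ 2) + √(0 + (l - 1) * dist Z V ^ 2) := by
    intro l hl
    obtain ⟨ρ, hρ, hρD, hf⟩ := hM.exists_almostFlat hl
    have small : ∀ X Y : TangentCone p, ∀ᶠ t in 𝓝[>] (0 : ℝ),
        dist (expCurve X t) (expCurve Y t) < ρ := by
      intro X Y
      have h1 := (hM.tendsto_dist_expCurve X Y).mul
        (tendsto_id.mono_left (nhdsWithin_le_nhds (a := (0 : ℝ)) (s := Ioi 0)))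
      rw [mul_zero] at h1
      filter_upwards [h1.eventually (gt_mem_nhds hρ), self_mem_nhdsWithin] with t ht ht0
      rwa [id, div_mul_cancel₀ _ (ne_of_gt ht0)] at ht
    have path : ∀ x y : M, dist x y < ρ → ∃ c, IsShortestPath x y c := fun x y hxy =>
      hM.exists_shortestPath x y fun hk => hxy.trans (hρD hk)
    set g : TangentCone p → ℝ → ℝ := fun X t =>
      (1 - τ) * (dist (expCurve X t) (expCurve U t) / t) ^ 2
        + τ * (dist (expCurve X t) (expCurve V t) / t) ^ 2
        - τ * (1 - τ) * (dist (expCurve U t) (expCurve V t) / t) ^ 2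
        + (l - 1) * (dist (expCurve X t) (expCurve V t) / t) ^ 2 with hg
    have hglim : ∀ X, Tendsto (g X) (𝓝[>] 0) (𝓝 ((1 - τ) * dist X U ^ 2 + τ * dist X V ^ 2
        - τ * (1 - τ) * dist U V ^ 2 + (l - 1) * dist X V ^ 2)) := fun X =>
      (((((hM.tendsto_dist_expCurve X U).pow 2).const_mul _).add
        (((hM.tendsto_dist_expCurve X V).pow 2).const_mul _)).sub
        (((hM.tendsto_dist_expCurve U V).pow 2).const_mul _)).add
        (((hM.tendsto_dist_expCurve X V).pow 2).const_mul _)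
    -- The CN bound tested at `Z` itself is zero, which forces the point `m` below to lie near
    -- `expCurve Z t` at scale `t`.
    have hZ0 : (1 - τ) * dist Z U ^ 2 + τ * dist Z V ^ 2 - τ * (1 - τ) * dist U V ^ 2 = 0 := by
      rw [dist_comm Z U, hU, hV]; ring
    have hlim := (hglim W).sqrt.add (hglim Z).sqrt
    rw [hZ0, ← hB] at hlim
    refine le_of_tendsto_of_tendsto (hM.tendsto_dist_expCurve W Z) hlim ?_
    filter_upwards [small U V, small U W, small U Z, self_mem_nhdsWithin] with t h1 h2 h3 ht
    have ht0 : 0 < t := ht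
    obtain ⟨c, hc⟩ := path _ _ h1
    obtain ⟨e, he⟩ := path _ _ h2
    obtain ⟨e', he'⟩ := path _ _ h3
    -- Nothing says that `expCurve Z t` lies on the shortest path from `expCurve U t` to `expCurve V
    -- t`. The point `m` of that path is estimated from both `W` and `Z`, and the two estimates are
    -- joined by the triangle inequality.
    set m := c (τ * dist (expCurve U t) (expCurve V t))
    have est : ∀ X e, IsShortestPath (expCurve U t) (expCurve X t) e →
        dist (expCurve U t) (expCurve X t) < ρ → dist (expCurve X t) m / t ≤ √(g X t) := by
      intro X e he hX
      refine Real.le_sqrt_of_sq_le ?_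
      have := hf.dist_sq_le hl.le hc he h1.le hX.le hτ
      simp only [hg, div_pow]
      rw [div_le_iff₀ (by positivity)]
      refine this.trans (le_of_eq ?_)
      field_simp
    calc dist (expCurve W t) (expCurve Z t) / t
        ≤ (dist (expCurve W t) m + dist (expCurve Z t) m) / t := by
          gcongr
          exact dist_triangle_right _ _ _
      _ = dist (expCurve W t) m / t + dist (expCurve Z t) m / t := add_div _ _ _
      _ ≤ _ := add_le_add (est W e he h2) (est Z e' he' h3)
  have hcont : Continuous fun l : ℝ => √(B + (l - 1) * dist W V ^ 2) + √(0 + (l - 1) * dist Z V ^ 2) := by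
    fun_prop
  have hlim := (hcont.tendsto 1).mono_left (nhdsWithin_le_nhds (s := Ioi 1))
  have h1 : dist W Z ≤ √(B + (1 - 1) * dist W V ^ 2) + √(0 + (1 - 1) * dist Z V ^ 2) :=
    ge_of_tendsto hlim (by filter_upwards [self_mem_nhdsWithin] with l hl using main l hl)
  simp only [sub_self, zero_mul, add_zero, Real.sqrt_zero] at h1
  -- The root of a negative `B` would be `0` and force `W = Z`, for which `B = 0`.
  have hB0 : 0 ≤ B := by
    by_contra! hneg
    rw [Real.sqrt_eq_zero'.mpr hneg.le] at h1
    have hWZ : W = Z := dist_le_zero.mp h1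
    subst hWZ
    rw [dist_comm W U, hU, hV] at hB
    nlinarith
  calc dist W Z ^ 2 ≤ √B ^ 2 := by gcongr
    _ = B := Real.sq_sqrt hB0

/-- The inner product with a fixed tangent vector is concave. -/
lemma IsCAT.innerProd_concave (hM : IsCAT κ M) {p : M} {U V Z : TangentCone p} (X : TangentCone p)
    {τ : ℝ} (hτ : τ ∈ Icc (0 : ℝ) 1) (hU : dist U Z = τ * dist U V)
    (hV : dist Z V = (1 - τ) * dist U V) :
    (1 - τ) * X.innerProd U + τ * X.innerProd V ≤ X.innerProd Z := by
  by_contra! hcon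
  set I := (1 - τ) * X.innerProd U + τ * X.innerProd V - X.innerProd Z with hI
  have hI0 : 0 < I := by linarith
  set C := (1 - τ) * U.length ^ 2 + τ * V.length ^ 2 - Z.length ^ 2
    - τ * (1 - τ) * dist U V ^ 2 with hC
  -- The weights `1 - τ` and `τ` add up to `1`, so the terms `s² ‖X‖²` cancel. What remains is
  -- linear in `s` with a bound `C` independent of `s`, which is impossible for `I > 0`.
  have h : ∀ s : ℝ, 0 ≤ s → 2 * s * I ≤ C := by
    intro s hs
    have := hM.cone_dist_sq_le (X.scale s) hτ hU hV
    simp only [TangentCone.dist_sq (X.scale s), TangentCone.innerProd_scale hs] at this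
    rw [hC, hI]
    linarith
  have h1 := h ((|C| + 1) / I) (by positivity)
  have h2 : 2 * ((|C| + 1) / I) * I = 2 * (|C| + 1) := by field_simp
  linarith [le_abs_self C, abs_nonneg C]

end Comparison

/-! ### Stability of shortest paths -/

section Stability

variable {M : Type*} [MetricSpace M] {κ : ℝ} {p x : M} {c : ℝ → M}

lemma HasUniqueShortestPath.symm (h : HasUniqueShortestPath p x) : HasUniqueShortestPath x p := by
  obtain ⟨⟨c, hc⟩, h2⟩ := h
  refine ⟨⟨_, hc.reverse⟩, fun e f he hf s hs => ?_⟩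
  rw [dist_comm] at hs
  have := h2 _ _ he.reverse hf.reverse (x := dist p x - s) ⟨by linarith [hs.2], by linarith [hs.1]⟩
  simpa [dist_comm x p] using this

/-- As `y → x`, the comparison triangle of `p, x, y` has vanishing angle at `p`, hence a vanishing
side between the two points at distance `s`. The half-angle law makes this explicit. -/
lemma IsCAT.eventually_dist_lt_of_ltModelDiam (hM : IsCAT κ M) (hc : IsShortestPath p x c)
    (hD : LtModelDiam κ (dist p x)) {s : ℝ} (hs : s ∈ Ico 0 (dist p x)) {ε : ℝ} (hε : 0 < ε) :
    ∀ᶠ y in 𝓝 x, (∃ e, IsShortestPath p y e) ∧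
      ∀ e, IsShortestPath p y e → dist (c s) (e s) < ε := by
  have ha : 0 < dist p x := hs.1.trans_lt hs.2
  -- The cap by `dist p x` keeps `δ / 2` below the model diameter, where the model sine is positive.
  have hδ : 0 < min ε (dist p x) := lt_min hε ha
  set δ := min ε (dist p x) with hδdef
  have hη : 0 < modelSin κ (δ / 2) := modelSin_pos (by positivity) fun hk => by
    have := hD hk
    have : δ ≤ dist p x := min_le_right _ _
    linarith
  have hsa := modelSin_pos ha hD
  have hcs := continuous_modelSin κ
  have e1 : ∀ᶠ y in 𝓝 x, s < dist p y :=
    (continuous_const.dist continuous_id).continuousAt.eventually (lt_mem_nhds hs.2)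
  have e2 : ∀ᶠ y in 𝓝 x, LtModelDiam κ (dist p y) := by
    by_cases hk : 0 < κ
    · have hcont : Continuous fun y : M => dist p y := by fun_prop
      filter_upwards [hcont.continuousAt.eventually (gt_mem_nhds (hD hk))] with y hy _ using hy
    · exact Eventually.of_forall fun y h => absurd h hk
  have e3 : ∀ᶠ y in 𝓝 x, LtModelDiam κ ((dist p x + dist x y + dist y p) / 2) := by
    by_cases hk : 0 < κ
    · have hcont : Continuous fun y : M => (dist p x + dist x y + dist y p) / 2 := by fun_prop
      have h0 : (dist p x + dist x x + dist x p) / 2 < Real.pi / √κ := by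
        simpa [dist_comm x p] using hD hk
      filter_upwards [hcont.continuousAt.eventually (gt_mem_nhds h0)] with y hy _ using hy
    · exact Eventually.of_forall fun y h => absurd h hk
  -- This results from eliminating `1 - cos θ` between the laws for the sides `(s, s)` and `(dist p
  -- x, dist p y)`. At `y = x` the left side vanishes.
  have e4 : ∀ᶠ y in 𝓝 x, modelSin κ s ^ 2 * (modelSin κ ((dist x y + (dist p x - dist p y)) / 2)
      * modelSin κ ((dist x y - (dist p x - dist p y)) / 2))
      < modelSin κ (δ / 2) ^ 2 * (modelSin κ (dist p x) * modelSin κ (dist p y)) := by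
    have hl : Continuous fun y : M =>
        modelSin κ s ^ 2 * (modelSin κ ((dist x y + (dist p x - dist p y)) / 2)
        * modelSin κ ((dist x y - (dist p x - dist p y)) / 2)) := by fun_prop
    have hr : Continuous fun y : M =>
        modelSin κ (δ / 2) ^ 2 * (modelSin κ (dist p x) * modelSin κ (dist p y)) := by fun_prop
    refine (isOpen_lt hl hr).mem_nhds ?_
    simp only [mem_ofPred_eq, dist_self, sub_self, add_zero, zero_div, modelSin_zero, mul_zero]
    positivity
  filter_upwards [e1, e2, e3, e4] with y h1 h2 h3 h4
  refine ⟨hM.exists_shortestPath p y h2, fun e he => ?_⟩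
  have hb : 0 < dist p y := hs.1.trans_lt h1
  have hxy : |dist p x - dist p y| ≤ dist x y := by
    have := abs_dist_sub_le x y p
    rwa [dist_comm x p, dist_comm y p] at this
  obtain ⟨θ, hθ, hθd⟩ := exists_modelSide_eq (κ := κ) dist_nonneg dist_nonneg hxy
    (dist_triangle_left x y p) (fun hk => by
      have := h3 hk
      rw [dist_comm y p] at this
      linarith)
  have hcmp := hM.comparison p x y h3 c e hc he θ hθ hθd s ⟨hs.1, hs.2.le⟩ s ⟨hs.1, h1.le⟩
  refine hcmp.trans_lt ?_
  by_contra! hcon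
  have hsD : 0 < κ → s ≤ Real.pi / √κ := fun hk => (hs.2.trans (hD hk)).le
  obtain ⟨-, l1, l2⟩ := modelSide_law (κ := κ) θ hs.1 hs.1 hsD hsD
  obtain ⟨-, -, l3⟩ := modelSide_law (κ := κ) θ (dist_nonneg (x := p) (y := x))
    (dist_nonneg (x := p) (y := y)) (fun hk => (hD hk).le) (fun hk => (h2 hk).le)
  rw [← hθd] at l3
  set m := modelSide κ s s θ
  simp only [sub_self, add_zero, sub_zero] at l2
  have hmono : modelSin κ (δ / 2) ≤ modelSin κ (m / 2) := by
    refine modelSin_le_modelSin (by positivity) ?_ fun hk => by linarith [l1 hk]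
    have : δ ≤ ε := min_le_left _ _
    linarith
  have hsb := modelSin_pos hb h2
  have hsq : modelSin κ (δ / 2) ^ 2 ≤ modelSin κ (m / 2) ^ 2 := by gcongr
  have hle : modelSin κ (δ / 2) ^ 2 * (modelSin κ (dist p x) * modelSin κ (dist p y))
      ≤ modelSin κ (m / 2) ^ 2 * (modelSin κ (dist p x) * modelSin κ (dist p y)) := by gcongr
  have heq : modelSin κ (m / 2) ^ 2 * (modelSin κ (dist p x) * modelSin κ (dist p y))
      = modelSin κ s ^ 2 * (modelSin κ ((dist x y + (dist p x - dist p y)) / 2)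
      * modelSin κ ((dist x y - (dist p x - dist p y)) / 2)) := by
    linear_combination (modelSin κ (dist p x) * modelSin κ (dist p y) / 2) * l2
      - (modelSin κ s ^ 2 / 2) * l3
  linarith

/-- If paths to points `y → x` stayed `ε` away at `s`, their pointwise limit along an ultrafilter,
which exists by compactness of balls, would be a second shortest path from `p` to `x`. -/
lemma eventually_dist_lt_of_properSpace [ProperSpace M] (hgeo : IsGeodesicSpace M)
    (hu : HasUniqueShortestPath p x) (hc : IsShortestPath p x c) {s : ℝ}
    (hs : s ∈ Ico 0 (dist p x)) {ε : ℝ} (hε : 0 < ε) :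
    ∀ᶠ y in 𝓝 x, ∀ e, IsShortestPath p y e → dist (c s) (e s) < ε := by
  by_contra hcon
  rw [not_eventually] at hcon
  have hex : ∀ y, ∃ e, IsShortestPath p y e ∧
      ((¬ ∀ e, IsShortestPath p y e → dist (c s) (e s) < ε) → ε ≤ dist (c s) (e s)) := by
    intro y
    by_cases h : ∀ e, IsShortestPath p y e → dist (c s) (e s) < ε
    · obtain ⟨e, he⟩ := hgeo p y
      exact ⟨e, he, fun h' => absurd h h'⟩
    · push Not at h
      obtain ⟨e, he, hle⟩ := h
      exact ⟨e, he, fun _ => hle⟩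
  choose e he hbad using hex
  rw [frequently_iff_neBot] at hcon
  obtain ⟨U, hU⟩ := Ultrafilter.exists_le (𝓝 x ⊓ 𝓟 {y | ¬ ∀ e, IsShortestPath p y e →
    dist (c s) (e s) < ε})
  have hUx : (U : Filter M) ≤ 𝓝 x := hU.trans inf_le_left
  have hUbad : ∀ᶠ y in (U : Filter M), ε ≤ dist (c s) (e y s) := by
    filter_upwards [hU.trans inf_le_right (mem_principal_self _)] with y hy using hbad y hy
  have hdU : Tendsto (fun y => dist p y) U (𝓝 (dist p x)) :=
    ((continuous_const.dist continuous_id).tendsto x).mono_left hUx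
  -- Clamping keeps the parameter in `[0, dist p y]`, outside of which nothing is known about `e y`.
  set φ : M → ℝ → ℝ := fun y t => max 0 (min t (dist p y)) with hφ
  have hφmem : ∀ y t, φ y t ∈ Icc 0 (dist p y) := fun y t =>
    ⟨le_max_left _ _, max_le dist_nonneg (min_le_right _ _)⟩
  have hφU : ∀ t ∈ Icc 0 (dist p x), Tendsto (fun y => φ y t) U (𝓝 t) := fun t ht => by
    have h1 : Tendsto (fun y => φ y t) U (𝓝 (max 0 (min t (dist p x)))) :=
      tendsto_const_nhds.max (tendsto_const_nhds.min hdU)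
    rwa [min_eq_left ht.2, max_eq_right ht.1] at h1
  have hlim : ∀ t, ∃ z, Tendsto (fun y => e y (φ y t)) U (𝓝 z) := by
    intro t
    have hb : ∀ᶠ y in (U : Filter M), e y (φ y t) ∈ Metric.closedBall p (dist p x + 1) := by
      filter_upwards [hdU.eventually (gt_mem_nhds (lt_add_one _))] with y hy
      rw [Metric.mem_closedBall, dist_comm, (he y).dist_left (hφmem y t)]
      exact (hφmem y t).2.trans hy.le
    obtain ⟨z, -, hz⟩ := (isCompact_closedBall p (dist p x + 1)).ultrafilter_le_nhds
      (U.map fun y => e y (φ y t)) (le_principal_iff.mpr hb)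
    exact ⟨z, hz⟩
  choose g hg using hlim
  have hgc : IsShortestPath p x g := by
    refine ⟨?_, ?_, ?_⟩
    · refine tendsto_nhds_unique (hg 0) (tendsto_const_nhds.congr fun y => ?_)
      rw [show φ y 0 = 0 by simp [hφ], (he y).start]
    · have h1 : Tendsto (fun y => dist (e y (φ y (dist p x))) y) U (𝓝 (dist (g (dist p x)) x)) :=
        (hg _).dist hUx
      have h2 : Tendsto (fun y => dist p y - φ y (dist p x)) U (𝓝 (dist p x - dist p x)) :=
        hdU.sub (hφU _ ⟨dist_nonneg, le_rfl⟩)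
      have h3 := tendsto_nhds_unique h1 (h2.congr fun y => ((he y).dist_right (hφmem y _)).symm)
      rw [sub_self] at h3
      exact dist_eq_zero.mp h3
    · intro u hu v hv
      have h1 := (hg u).dist (hg v)
      have h2 := ((hφU u hu).sub (hφU v hv)).abs
      exact tendsto_nhds_unique h1 (h2.congr fun y =>
        ((he y).isometric _ (hφmem y u) _ (hφmem y v)).symm)
  have hgs : g s = c s := hu.2 g c hgc hc ⟨hs.1, hs.2.le⟩
  have h1 : Tendsto (fun y => dist (c s) (e y (φ y s))) U (𝓝 0) := by
    have := (tendsto_const_nhds (x := c s)).dist (hg s)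
    rwa [hgs, dist_self] at this
  obtain ⟨y, hy1, hy2, hy3⟩ := ((h1.eventually (gt_mem_nhds hε)).and
    (hUbad.and (hdU.eventually (lt_mem_nhds hs.2)))).exists
  rw [show φ y s = s by simp [hφ, hs.1, hy3.le]] at hy1
  linarith

/-- Shortest paths from `p` to points near `x` are close to the shortest path from `p` to `x`. -/
lemma IsCAT.eventually_dist_lt (hM : IsCAT κ M) (hu : HasUniqueShortestPath p x)
    (hreg : (IsGeodesicSpace M ∧ ProperSpace M) ∨ LtModelDiam κ (dist p x))
    (hc : IsShortestPath p x c) {s : ℝ} (hs : s ∈ Ico 0 (dist p x)) {ε : ℝ} (hε : 0 < ε) :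
    ∀ᶠ y in 𝓝 x, (∃ e, IsShortestPath p y e) ∧
      ∀ e, IsShortestPath p y e → dist (c s) (e s) < ε := by
  rcases hreg with ⟨hgeo, hprop⟩ | hD
  · filter_upwards [eventually_dist_lt_of_properSpace hgeo hu hc hs hε] with y hy
      using ⟨hgeo p y, hy⟩
  · exact hM.eventually_dist_lt_of_ltModelDiam hc hD hs hε

/-! ### Continuity of the logarithm -/

lemma AlmostFlat.angle_shortestPath_le {l ρ : ℝ} (h : AlmostFlat M l ρ) (hl : 0 ≤ l) {y : M}
    {e : ℝ → M} (hc : IsShortestPath p x c) (he : IsShortestPath p y e) (hx : p ≠ x) (hy : p ≠ y)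
    {a b : ℝ} (ha : 0 < a) (hb : 0 < b) (haρ : a ≤ ρ) (hbρ : b ≤ ρ) (hax : a ≤ dist p x)
    (hby : b ≤ dist p y) :
    2 * a * b * (1 - Real.cos ((hc.toGeodesicFrom hx).angle (he.toGeodesicFrom hy)))
      ≤ l * (dist (c a) (e b) ^ 2 - (a - b) ^ 2) :=
  h.angle_le hl _ _ ha hb haρ hbρ (hc.dist_left ⟨ha.le, hax⟩) (he.dist_left ⟨hb.le, hby⟩)
    (hc.restrict ⟨ha.le, hax⟩) (he.restrict ⟨hb.le, hby⟩)

lemma exists_logMap_eq (hu : HasUniqueShortestPath p x) (hx : p ≠ x) :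
    ∃ (c : ℝ → M) (hc : IsShortestPath p x c), logMap p x
      = TangentCone.ray (Direction.mk (hc.toGeodesicFrom hx)) (dist p x) (dist_pos.mpr hx) :=
  ⟨_, hu.1.choose_spec, by rw [logMap, dif_pos ⟨hu, hx⟩]⟩

lemma logMap_self (p : M) : logMap p p = TangentCone.apex := by
  rw [logMap, dif_neg fun h => h.2 rfl]

/-- Only an inequality, because the default value `apex` has length `0`; in return it holds
everywhere and serves for domination. -/
lemma length_logMap_le (p x : M) : (logMap p x).length ≤ dist p x := by
  rw [logMap]
  split_ifs with h
  · exact le_rfl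
  · exact dist_nonneg

/-- Lengths vary continuously, and the angle between the paths to `x` and `y` is controlled by their
distance at one fixed small parameter `s`, which stability makes small. The factor `2` in
`AlmostFlat` is harmless here. -/
lemma IsCAT.continuousWithinAt_logMap (hM : IsCAT κ M) (hu : HasUniqueShortestPath p x)
    (hreg : (IsGeodesicSpace M ∧ ProperSpace M) ∨ LtModelDiam κ (dist p x)) :
    ContinuousWithinAt (logMap p) {y | HasUniqueShortestPath p y} x := by
  rw [ContinuousWithinAt, Metric.tendsto_nhds]
  intro ε hε
  rcases eq_or_ne p x with rfl | hx
  · filter_upwards [mem_nhdsWithin_of_mem_nhds (Metric.ball_mem_nhds p hε)] with y hy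
    rw [logMap_self, TangentCone.dist_apex_right]
    exact (length_logMap_le p y).trans_lt (by rwa [dist_comm])
  obtain ⟨c, hc, hlog⟩ := exists_logMap_eq hu hx
  obtain ⟨ρ, hρ, -, hf⟩ := hM.exists_almostFlat one_lt_two
  have ha : 0 < dist p x := dist_pos.mpr hx
  set a := dist p x with hadef
  obtain ⟨s, hs0, hs⟩ := exists_between (lt_min hρ ha)
  have hsρ := hs.trans_le (min_le_left _ _)
  have hsa := hs.trans_le (min_le_right _ _)
  -- Chosen so that the angular term `2 a (dist p y) (1 - cos)` is at most `ε² / 2`, given `dist p y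
  -- < a + 1`; the radial term takes the other half.
  set δ := ε * s / (2 * (a + 1)) with hδ
  have hδ0 : 0 < δ := by positivity
  have e1 := hM.eventually_dist_lt hu hreg hc ⟨hs0.le, hsa⟩ hδ0
  have hcd : Continuous fun y : M => dist p y := continuous_const.dist continuous_id
  have e2 : ∀ᶠ y in 𝓝 x, s < dist p y := hcd.continuousAt.eventually (lt_mem_nhds hsa)
  have e3 : ∀ᶠ y in 𝓝 x, dist p y < a + 1 := hcd.continuousAt.eventually
    (gt_mem_nhds (lt_add_one a))
  have hcd2 : Continuous fun y : M => (a - dist p y) ^ 2 := by fun_prop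
  have hε2 : 0 < ε ^ 2 / 2 := by positivity
  have e4 : ∀ᶠ y in 𝓝 x, (a - dist p y) ^ 2 < ε ^ 2 / 2 :=
    hcd2.continuousAt.eventually (gt_mem_nhds (by simpa [← hadef] using hε2))
  filter_upwards [mem_nhdsWithin_of_mem_nhds e1, mem_nhdsWithin_of_mem_nhds e2,
    mem_nhdsWithin_of_mem_nhds e3, mem_nhdsWithin_of_mem_nhds e4, self_mem_nhdsWithin]
    with y h1 h2 h3 h4 hyu
  have hy : p ≠ y := dist_pos.mp (hs0.trans h2)
  obtain ⟨e, he, hlogy⟩ := exists_logMap_eq hyu hy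
  have hd := h1.2 e he
  have hang := hf.angle_shortestPath_le zero_le_two hc he hx hy hs0 hs0 hsρ.le hsρ.le hsa.le h2.le
  rw [sub_self, zero_pow two_ne_zero, sub_zero] at hang
  have hsq : dist (c s) (e s) ^ 2 < δ ^ 2 := by gcongr
  have hcos : 1 - Real.cos ((hc.toGeodesicFrom hx).angle (he.toGeodesicFrom hy))
      < (ε / (2 * (a + 1))) ^ 2 := by
    have h5 : s ^ 2 * (1 - Real.cos ((hc.toGeodesicFrom hx).angle (he.toGeodesicFrom hy)))
        < s ^ 2 * (ε / (2 * (a + 1))) ^ 2 := by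
      have : δ ^ 2 = s ^ 2 * (ε / (2 * (a + 1))) ^ 2 := by rw [hδ]; field_simp
      linarith
    exact lt_of_mul_lt_mul_left h5 (by positivity)
  refine lt_of_pow_lt_pow_left₀ 2 hε.le ?_
  rw [dist_comm, TangentCone.dist_sq, hlog, hlogy]
  simp only [TangentCone.length, TangentCone.innerProd, Direction.angle_mk]
  rw [← hadef]
  set K := 1 - Real.cos ((hc.toGeodesicFrom hx).angle (he.toGeodesicFrom hy)) with hK
  have hK0 : 0 ≤ K := by rw [hK]; linarith [Real.cos_le_one ((hc.toGeodesicFrom hx).angle (he.toGeodesicFrom hy))]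
  have h6 : 2 * a * dist p y * K ≤ ε ^ 2 / 2 := by
    calc 2 * a * dist p y * K ≤ 2 * (a + 1) * (a + 1) * (ε / (2 * (a + 1))) ^ 2 := by
          gcongr; linarith
      _ = ε ^ 2 / 2 := by field_simp
  rw [show Real.cos ((hc.toGeodesicFrom hx).angle (he.toGeodesicFrom hy)) = 1 - K by rw [hK]; ring]
  linarith

end Stability

/-! ### First variation -/

section FirstVariation

variable {M : Type*} [MetricSpace M] {κ : ℝ} {p x : M} {c : ℝ → M}

lemma GeodesicFrom.tendsto_start (γ : GeodesicFrom p) : Tendsto γ.toFun (𝓝[>] 0) (𝓝 p) := by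
  rw [tendsto_iff_dist_tendsto_zero]
  refine (tendsto_id.mono_left (nhdsWithin_le_nhds (a := (0 : ℝ)) (s := Ioi 0))).congr' ?_
  filter_upwards [Ioo_mem_nhdsGT γ.length_pos] with t ht
  rw [dist_comm, γ.dist_left (Ioo_subset_Ico_self ht), id]

/-- The detour through `c s` with `s = √t` costs at most `D - s ≤ (D² - s²) / (2 s)`, where `D =
dist (γ t) (c s)`. Since `s → 0`, the comparison angle converges to the angle; since `t / s → 0`,
the error `s / 2` vanishes after division by `t`. -/
lemma IsCAT.eventually_slope_dist_lt (hM : IsCAT κ M) (γ : GeodesicFrom p) (hx : p ≠ x)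
    (hc : IsShortestPath p x c) {w : ℝ}
    (hw : -Real.cos (γ.angle (hc.toGeodesicFrom hx)) < w) :
    ∀ᶠ t in 𝓝[>] (0 : ℝ), (dist (γ.toFun t) x - dist p x) / t < w := by
  have hsqrt : Tendsto (fun t : ℝ => √t) (𝓝[>] 0) (𝓝[>] 0) := by
    refine tendsto_nhdsWithin_iff.mpr ⟨?_, ?_⟩
    · have := Real.continuous_sqrt.tendsto 0
      rw [Real.sqrt_zero] at this
      exact this.mono_left nhdsWithin_le_nhds
    · filter_upwards [self_mem_nhdsWithin] with t ht using Real.sqrt_pos.mpr ht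
  have h1 := (hM.tendsto_comparison γ (hc.toGeodesicFrom hx)).comp
    (tendsto_id.prodMk hsqrt)
  have h2 : Tendsto (fun t : ℝ => √t / 2) (𝓝[>] 0) (𝓝 0) := by
    have := (hsqrt.mono_right nhdsWithin_le_nhds).div_const 2
    rwa [zero_div] at this
  have h3 := h2.add (h1.sub_const 1)
  rw [show 0 + (1 - Real.cos (γ.angle (hc.toGeodesicFrom hx)) - 1)
    = -Real.cos (γ.angle (hc.toGeodesicFrom hx)) by ring] at h3
  have hdx : 0 < dist p x := dist_pos.mpr hx
  filter_upwards [h3.eventually (gt_mem_nhds hw), self_mem_nhdsWithin,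
    hsqrt.eventually (Ioo_mem_nhdsGT hdx)] with t h4 ht hs
  have ht0 : 0 < t := ht
  set s := √t with hsdef
  have hst : t = s * s := (Real.mul_self_sqrt ht0.le).symm
  have hs0 : 0 < s := hs.1
  refine lt_of_le_of_lt ?_ h4
  simp only [Function.comp, id]
  change _ ≤ s / 2 + ((dist (γ.toFun t) (c s) ^ 2 - (t - s) ^ 2) / (2 * t * s) - 1)
  have htri := dist_triangle (γ.toFun t) (c s) x
  rw [hc.dist_right (Ioo_subset_Icc_self hs)] at htri
  set D := dist (γ.toFun t) (c s)
  have h5 : s / 2 + ((D ^ 2 - (t - s) ^ 2) / (2 * t * s) - 1) = (D ^ 2 - s ^ 2) / (2 * s) / t := by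
    rw [hst]; field_simp; ring
  rw [h5]
  gcongr
  rw [le_div_iff₀ (by positivity)]
  nlinarith [sq_nonneg (D - s)]

/-- On the shortest path from `x` to `γ t`, let `q` be the point at distance `dist p x - s` from
`x`. By stability `q` is near `c s`, so the angle at `p` between `γ` and the path to `q` is near the
angle with `c`. Comparison in the small triangle `p, γ t, q` then bounds `dist q (γ t)` from below,
while `dist p q ≥ s` by the triangle inequality. -/
lemma IsCAT.lt_eventually_slope_dist (hM : IsCAT κ M) (γ : GeodesicFrom p) (hx : p ≠ x)
    (hu : HasUniqueShortestPath p x)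
    (hreg : (IsGeodesicSpace M ∧ ProperSpace M) ∨ LtModelDiam κ (dist p x))
    (hc : IsShortestPath p x c) {w : ℝ}
    (hw : w < -Real.cos (γ.angle (hc.toGeodesicFrom hx))) :
    ∀ᶠ t in 𝓝[>] (0 : ℝ), w < (dist (γ.toFun t) x - dist p x) / t := by
  set c' := hc.toGeodesicFrom hx with hc'
  obtain ⟨l, hl1, hlw⟩ : ∃ l : ℝ, 1 < l ∧ w < (1 - Real.cos (γ.angle c')) / l - 1 := by
    have hcont : ContinuousAt (fun l : ℝ => (1 - Real.cos (γ.angle c')) / l - 1) 1 :=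
      (continuousAt_const.div continuousAt_id one_ne_zero).sub continuousAt_const
    have : ∀ᶠ l in 𝓝[>] (1 : ℝ), w < (1 - Real.cos (γ.angle c')) / l - 1 :=
      (hcont.tendsto.mono_left nhdsWithin_le_nhds).eventually (lt_mem_nhds (by
        rw [div_one]; linarith))
    obtain ⟨l, h1, h2⟩ := (this.and self_mem_nhdsWithin).exists
    exact ⟨l, h2, h1⟩
  have hl0 : 0 < l := by linarith
  obtain ⟨ρ, hρ, hρD, hf⟩ := hM.exists_almostFlat hl1
  have hθ : ∀ᶠ θ in 𝓝 (γ.angle c'), w < (1 - Real.cos θ) / l - 1 := by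
    have hcont : Continuous fun θ : ℝ => (1 - Real.cos θ) / l - 1 := by fun_prop
    exact hcont.continuousAt.eventually (lt_mem_nhds hlw)
  obtain ⟨δ, hδ, hθ⟩ := Metric.eventually_nhds_iff.mp hθ
  have hdx : 0 < dist p x := dist_pos.mpr hx
  obtain ⟨s, hs0, hs⟩ := exists_between (lt_min hρ hdx)
  have hsρ := hs.trans_le (min_le_left _ _)
  have hsx := hs.trans_le (min_le_right _ _)
  have hδ' : 0 < min δ Real.pi := lt_min hδ Real.pi_pos
  have hcosδ : 0 < 1 - Real.cos (min δ Real.pi) := by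
    have := Real.cos_lt_cos_of_nonneg_of_le_pi le_rfl (min_le_right δ Real.pi) hδ'
    rw [Real.cos_zero] at this
    linarith
  -- The first bound keeps `q` within the radius `ρ` of almost flatness; the second forces the angle
  -- at `p` between the paths to `x` and `q` below `δ`.
  obtain ⟨ε, hε0, hε1, hε2⟩ : ∃ ε > 0, ε < ρ - s ∧
      l * ε ^ 2 < 2 * s ^ 2 * (1 - Real.cos (min δ Real.pi)) := by
    have hcont : Continuous fun ε : ℝ => l * ε ^ 2 := by fun_prop
    have h1 : ∀ᶠ ε in 𝓝[>] (0 : ℝ), l * ε ^ 2 < 2 * s ^ 2 * (1 - Real.cos (min δ Real.pi)) :=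
      (hcont.continuousAt.tendsto.mono_left nhdsWithin_le_nhds).eventually (gt_mem_nhds (by
        simp only [ne_eq, OfNat.ofNat_ne_zero, not_false_eq_true, zero_pow, mul_zero]
        positivity))
    obtain ⟨ε, h1, h2⟩ := (h1.and (Ioo_mem_nhdsGT (show 0 < ρ - s by linarith))).exists
    exact ⟨ε, h2.1, h2.2, h1⟩
  have hreg' : (IsGeodesicSpace M ∧ ProperSpace M) ∨ LtModelDiam κ (dist x p) := by
    rwa [dist_comm x p]
  have hσ : dist p x - s ∈ Ico 0 (dist x p) := by
    rw [dist_comm x p]; exact ⟨by linarith, by linarith⟩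
  have hstab := hM.eventually_dist_lt hu.symm hreg' hc.reverse hσ hε0
  simp only [sub_sub_cancel] at hstab
  have hdc : Continuous fun y : M => dist x y := by fun_prop
  have hfar : ∀ᶠ y in 𝓝 p, dist p x - s < dist x y :=
    hdc.continuousAt.eventually (lt_mem_nhds hσ.2)
  filter_upwards [γ.tendsto_start.eventually hstab, γ.tendsto_start.eventually hfar,
    self_mem_nhdsWithin, Ioo_mem_nhdsGT γ.length_pos, Ioo_mem_nhdsGT hρ] with t h1 h2 ht ht1 ht2
  have ht0 : 0 < t := ht
  obtain ⟨⟨u, hu'⟩, hclose⟩ := h1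
  have hqc := hclose u hu'
  set σ := dist p x - s with hσdef
  have hσu : σ ∈ Icc 0 (dist x (γ.toFun t)) := ⟨hσ.1, h2.le⟩
  set q := u σ with hq
  have hxq : dist x q = σ := hu'.dist_left hσu
  have hqγ : dist q (γ.toFun t) = dist x (γ.toFun t) - σ := hu'.dist_right hσu
  have hps : dist p (c s) = s := hc.dist_left ⟨hs0.le, hsx.le⟩
  have hb1 : s ≤ dist p q := by
    have := dist_triangle p q x
    rw [dist_comm q x, hxq] at this
    linarith
  have hb2 : dist p q ≤ ρ := by
    have := dist_triangle p (c s) q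
    linarith
  have hpq : p ≠ q := dist_pos.mp (hs0.trans_le hb1)
  obtain ⟨v, hv⟩ := hM.exists_shortestPath p q fun hk => hb2.trans_lt (hρD hk)
  set η := hv.toGeodesicFrom hpq
  have hbpos : 0 < dist p q := dist_pos.mpr hpq
  have hηend : η.toFun (dist p q) = q := hv.finish
  have ang1 : 2 * t * dist p q * (1 - Real.cos (γ.angle η))
      ≤ l * (dist (γ.toFun t) q ^ 2 - (t - dist p q) ^ 2) := by
    have := hf.angle_le hl0.le γ η ht0 hbpos ht2.2.le hb2
      (γ.dist_left (Ioo_subset_Ico_self ht1)) (by rw [hηend])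
      (γ.isShortestPath (Ioo_subset_Ico_self ht1)) (by rw [hηend]; exact hv)
    rwa [hηend] at this
  have ang2 : 2 * s * dist p q * (1 - Real.cos (c'.angle η))
      ≤ l * (dist (c s) q ^ 2 - (s - dist p q) ^ 2) := by
    have := hf.angle_shortestPath_le hl0.le hc hv hx hpq hs0 hbpos hsρ.le hb2 hsx.le le_rfl
    rwa [hv.finish] at this
  have hsmall : c'.angle η < min δ Real.pi := by
    by_contra! hcon
    have h3 := Real.cos_le_cos_of_nonneg_of_le_pi hδ'.le (GeodesicFrom.angle_le_pi c' η) hcon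
    have h4 : dist (c s) q ^ 2 ≤ ε ^ 2 := by gcongr
    have h5 : 2 * s ^ 2 * (1 - Real.cos (min δ Real.pi))
        ≤ 2 * s * dist p q * (1 - Real.cos (c'.angle η)) := by
      calc 2 * s ^ 2 * (1 - Real.cos (min δ Real.pi))
          = 2 * s * s * (1 - Real.cos (min δ Real.pi)) := by ring
        _ ≤ _ := by gcongr
    have h6 : l * (dist (c s) q ^ 2 - (s - dist p q) ^ 2) ≤ l * ε ^ 2 := by
      gcongr
      linarith [sq_nonneg (s - dist p q)]
    linarith
  have hclose2 : w < (1 - Real.cos (γ.angle η)) / l - 1 := by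
    refine hθ ?_
    have t1 := GeodesicFrom.angle_triangle γ c' η
    have t2 := GeodesicFrom.angle_triangle γ η c'
    rw [GeodesicFrom.angle_comm η c'] at t2
    have := hsmall.trans_le (min_le_left _ _)
    rw [Real.dist_eq, abs_lt]
    constructor <;> linarith
  refine hclose2.trans_le ?_
  set β := (1 - Real.cos (γ.angle η)) / l with hβ
  have hβ0 : 0 ≤ β := div_nonneg (by linarith [Real.cos_le_one (γ.angle η)]) hl0.le
  have hβ2 : β ≤ 2 := by
    rw [hβ, div_le_iff₀ hl0]
    linarith [Real.neg_one_le_cos (γ.angle η)]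
  have hβl : 1 - Real.cos (γ.angle η) = l * β := by rw [hβ]; field_simp
  -- With `b = dist p q`, one has `(b - t)² + 2 t b β = (b - t (1 - β))² + t² β (2 - β)`, and the
  -- last term is nonnegative.
  have hsq : (dist p q - t * (1 - β)) ^ 2 ≤ dist q (γ.toFun t) ^ 2 := by
    rw [hβl, show 2 * t * dist p q * (l * β) = l * (2 * t * dist p q * β) by ring] at ang1
    have := le_of_mul_le_mul_left ang1 hl0
    rw [dist_comm q]
    nlinarith [mul_nonneg (mul_nonneg hβ0 (sub_nonneg.mpr hβ2)) (sq_nonneg t)]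
  have hle := abs_le_of_sq_le_sq hsq dist_nonneg
  have hle' := (le_abs_self _).trans hle
  rw [le_div_iff₀ ht0, dist_comm _ x]
  linarith

/-- The first variation formula. -/
lemma IsCAT.tendsto_slope_dist_sq (hM : IsCAT κ M) (γ : GeodesicFrom p)
    (hu : HasUniqueShortestPath p x)
    (hreg : (IsGeodesicSpace M ∧ ProperSpace M) ∨ LtModelDiam κ (dist p x)) :
    Tendsto (fun t => (dist (γ.toFun t) x ^ 2 - dist p x ^ 2) / t) (𝓝[>] (0 : ℝ))
      (𝓝 (-2 * (TangentCone.ray (Direction.mk γ) 1 one_pos).innerProd (logMap p x))) := by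
  rcases eq_or_ne p x with rfl | hx
  · rw [logMap_self, TangentCone.innerProd_apex_right, mul_zero]
    refine (tendsto_id.mono_left (nhdsWithin_le_nhds (a := (0 : ℝ)) (s := Ioi 0))).congr' ?_
    filter_upwards [Ioo_mem_nhdsGT γ.length_pos] with t ht
    have ht0 : 0 < t := ht.1
    rw [dist_self, dist_comm, γ.dist_left (Ioo_subset_Ico_self ht), id]
    field_simp
    ring
  obtain ⟨c, hc, hlog⟩ := exists_logMap_eq hu hx
  have h1 : Tendsto (fun t => (dist (γ.toFun t) x - dist p x) / t) (𝓝[>] (0 : ℝ))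
      (𝓝 (-Real.cos (γ.angle (hc.toGeodesicFrom hx)))) :=
    tendsto_order.mpr ⟨fun w hw => hM.lt_eventually_slope_dist γ hx hu hreg hc hw,
      fun w hw => hM.eventually_slope_dist_lt γ hx hc hw⟩
  have h2 : Tendsto (fun t => dist (γ.toFun t) x + dist p x) (𝓝[>] (0 : ℝ))
      (𝓝 (dist p x + dist p x)) := (γ.tendsto_start.dist tendsto_const_nhds).add_const _
  have h3 := h1.mul h2
  rw [hlog]
  simp only [TangentCone.innerProd, Direction.angle_mk, one_mul]
  convert h3 using 2
  · ring
  · ring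

end FirstVariation

/-! ### Integration -/

section Integration

variable {M : Type*} [MetricSpace M] [MeasurableSpace M] {p : M} {μ : Measure M}

/-- The set of points with a unique shortest path is not known to be measurable, so it is replaced
by a measurable conull subset, on which the logarithm is continuous. -/
lemma IsCAT.aemeasurable_logMap [BorelSpace M] {κ : ℝ} (hM : IsCAT κ M) (h : ∀ᵐ x ∂μ, HasUniqueShortestPath p x ∧
      ((IsGeodesicSpace M ∧ ProperSpace M) ∨ LtModelDiam κ (dist p x))) :
    AEMeasurable (logMap p) μ := by
  obtain ⟨t, htμ, htm, ht⟩ := h.exists_measurable_mem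
  have hcont : ContinuousOn (logMap p) t := fun x hx =>
    (hM.continuousWithinAt_logMap (ht x hx).1 (ht x hx).2).mono fun y hy => (ht y hy).1
  have := hcont.aemeasurable (μ := μ) htm
  rwa [Measure.restrict_eq_self_of_ae_mem htμ] at this

variable [IsProbabilityMeasure μ]

lemma HasFiniteSecondMoment.map_logMap (hμ : HasFiniteSecondMoment μ)
    (hlog : AEMeasurable (logMap p) μ) :
    HasFiniteSecondMoment (tangentialPushforward μ p) := by
  intro V
  have hm : Continuous fun X : TangentCone p => dist V X ^ 2 := by fun_prop
  refine (integrable_map_measure hm.measurable.aestronglyMeasurable hlog).mpr ?_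
  refine (((hμ p).const_mul 2).add (integrable_const (2 * V.length ^ 2))).mono'
    (hm.measurable.comp_aemeasurable hlog).aestronglyMeasurable ?_
  refine Eventually.of_forall fun y => ?_
  simp only [Function.comp, Pi.add_apply]
  rw [Real.norm_of_nonneg (by positivity)]
  have h1 := length_logMap_le p y
  have h2 : dist V (logMap p y) ≤ V.length + (logMap p y).length := by
    have := dist_triangle V TangentCone.apex (logMap p y)
    rwa [TangentCone.dist_apex_right, TangentCone.dist_apex_left] at this
  have h3 : dist V (logMap p y) ^ 2 ≤ (V.length + dist p y) ^ 2 := by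
    gcongr
    linarith
  nlinarith [sq_nonneg (V.length - dist p y)]

variable [BorelSpace M] {κ : ℝ}

lemma HasFiniteSecondMoment.integrable_dist (hμ : HasFiniteSecondMoment μ) (x : M) :
    Integrable (fun y => dist x y) μ := by
  refine ((hμ x).add (integrable_const (1 : ℝ))).mono'
    (continuous_const.dist continuous_id).measurable.aestronglyMeasurable ?_
  refine Eventually.of_forall fun y => ?_
  rw [Real.norm_of_nonneg dist_nonneg, Pi.add_apply]
  nlinarith [sq_nonneg (dist x y - 1), dist_nonneg (x := x) (y := y)]

lemma HasFiniteSecondMoment.integrable_innerProd (hμ : HasFiniteSecondMoment μ)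
    (hlog : AEMeasurable (logMap p) μ) (V : TangentCone p) :
    Integrable (fun y => V.innerProd (logMap p y)) μ := by
  refine ((hμ.integrable_dist p).const_mul V.length).mono'
    (V.continuous_innerProd.measurable.comp_aemeasurable hlog).aestronglyMeasurable ?_
  refine Eventually.of_forall fun y => (V.abs_innerProd_le _).trans ?_
  exact mul_le_mul_of_nonneg_left (length_logMap_le p y) V.length_nonneg

lemma IsCAT.hasDerivWithinAt_frechetFunction (hM : IsCAT κ M) (hμ : HasFiniteSecondMoment μ)
    (h : ∀ᵐ x ∂μ, HasUniqueShortestPath p x ∧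
      ((IsGeodesicSpace M ∧ ProperSpace M) ∨ LtModelDiam κ (dist p x))) (γ : GeodesicFrom p) :
    HasDerivWithinAt (fun t : ℝ => frechetFunction μ (γ.toFun t))
      (-∫ y, (TangentCone.ray (Direction.mk γ) 1 one_pos).innerProd (logMap p y) ∂μ) (Ici 0) 0 := by
  rw [← hasDerivWithinAt_Ioi_iff_Ici, hasDerivWithinAt_iff_tendsto_slope' self_notMem_Ioi]
  have key : Tendsto (fun t : ℝ => ∫ y, (dist (γ.toFun t) y ^ 2 - dist p y ^ 2) / t ∂μ) (𝓝[>] 0)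
      (𝓝 (∫ y, -2 * (TangentCone.ray (Direction.mk γ) 1 one_pos).innerProd (logMap p y) ∂μ)) := by
    -- Since `γ t` has distance `t` from `p`, the squared distances differ by at most `t (2 dist p y
    -- + t)`, and `t < 1`.
    refine tendsto_integral_filter_of_dominated_convergence (fun y => 2 * dist p y + 1) ?_ ?_ ?_ ?_
    · refine Eventually.of_forall fun t => Measurable.aestronglyMeasurable ?_
      have : Continuous fun y => (dist (γ.toFun t) y ^ 2 - dist p y ^ 2) / t := by fun_prop
      exact this.measurable
    · filter_upwards [Ioo_mem_nhdsGT γ.length_pos, Ioo_mem_nhdsGT one_pos] with t ht ht1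
      refine Eventually.of_forall fun y => ?_
      have ht0 : 0 < t := ht.1
      have hd := γ.dist_left (Ioo_subset_Ico_self ht)
      have h1 := dist_triangle p (γ.toFun t) y
      have h2 := dist_triangle_left (γ.toFun t) y p
      rw [hd] at h1 h2
      have hp := dist_nonneg (x := p) (y := y)
      have hg := dist_nonneg (x := γ.toFun t) (y := y)
      rw [norm_div, Real.norm_of_nonneg ht0.le, div_le_iff₀ ht0, Real.norm_eq_abs, abs_le]
      have ht2 := ht1.2
      constructor <;> nlinarith
    · exact ((hμ.integrable_dist p).const_mul 2).add (integrable_const 1)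
    · filter_upwards [h] with y hy using hM.tendsto_slope_dist_sq γ hy.1 hy.2
  have h2 := key.const_mul (1 / 2)
  rw [integral_const_mul, show ∀ I : ℝ, 1 / 2 * (-2 * I) = -I from fun I => by ring] at h2
  refine h2.congr' ?_
  filter_upwards [self_mem_nhdsWithin] with t ht
  rw [slope_def_field, frechetFunction, frechetFunction, γ.start, integral_div,
    integral_sub (hμ _) (hμ _)]
  ring

/-- The integral depends on `γ` only through its direction, whence independence of the chosen
geodesic. -/
lemma IsCAT.hasDerivWithinAt_frechetFunction_mul (hM : IsCAT κ M) (hμ : HasFiniteSecondMoment μ)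
    (h : ∀ᵐ x ∂μ, HasUniqueShortestPath p x ∧
      ((IsGeodesicSpace M ∧ ProperSpace M) ∨ LtModelDiam κ (dist p x))) (γ : GeodesicFrom p)
    {r : ℝ} (hr : 0 < r) :
    HasDerivWithinAt (fun t : ℝ => frechetFunction μ (γ.toFun (r * t)))
      (-∫ y, (TangentCone.ray (Direction.mk γ) r hr).innerProd (logMap p y) ∂μ) (Ici 0) 0 := by
  have h1 := hM.hasDerivWithinAt_frechetFunction hμ h γ
  have h2 : HasDerivWithinAt (fun t : ℝ => r * t) r (Ici 0) 0 := by
    simpa using ((hasDerivAt_id (0 : ℝ)).const_mul r).hasDerivWithinAt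
  rw [← mul_zero r] at h1
  have h3 := h1.comp (0 : ℝ) h2 (by
    intro t ht
    rw [mul_zero]
    exact mul_nonneg hr.le ht)
  refine h3.congr_deriv ?_
  have hV : ∀ y, (TangentCone.ray (Direction.mk γ) r hr).innerProd (logMap p y)
      = r * (TangentCone.ray (Direction.mk γ) 1 one_pos).innerProd (logMap p y) := fun y => by
    rw [← TangentCone.innerProd_scale hr.le]
    simp only [TangentCone.scale, hr, dif_pos, mul_one]
  simp only [hV, integral_const_mul]
  ring

lemma IsCAT.dirDeriv_frechetFunction (hM : IsCAT κ M) (hμ : HasFiniteSecondMoment μ)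
    (h : ∀ᵐ x ∂μ, HasUniqueShortestPath p x ∧
      ((IsGeodesicSpace M ∧ ProperSpace M) ∨ LtModelDiam κ (dist p x))) (V : TangentCone p) :
    dirDeriv (frechetFunction μ) V = -∫ y, V.innerProd (logMap p y) ∂μ := by
  cases V with
  | apex => simp [dirDeriv, expCurve, TangentCone.innerProd]
  | ray V r hr =>
    have h1 := hM.hasDerivWithinAt_frechetFunction_mul hμ h (Quotient.out V) hr
    rw [Direction.mk_out] at h1
    exact h1.derivWithin (uniqueDiffWithinAt_Ici 0)

/-- No limit of integrals is needed: the conical law of cosines makes the function a polynomial in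
`t ≥ 0`, with linear coefficient `-I`. -/
lemma HasFiniteSecondMoment.hasDerivWithinAt_tangentialPushforward (hμ : HasFiniteSecondMoment μ)
    (hlog : AEMeasurable (logMap p) μ) (V : TangentCone p) :
    HasDerivWithinAt (fun t : ℝ => frechetFunction (tangentialPushforward μ p) (V.scale t))
      (-∫ y, V.innerProd (logMap p y) ∂μ) (Ici 0) 0 := by
  set I := ∫ y, V.innerProd (logMap p y) ∂μ with hI
  set C := ∫ y, (logMap p y).length ^ 2 ∂μ with hC
  have hlen : Integrable (fun y => (logMap p y).length ^ 2) μ := by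
    have hm : Continuous fun X : TangentCone p => dist TangentCone.apex X ^ 2 := by fun_prop
    have := (integrable_map_measure hm.measurable.aestronglyMeasurable hlog).mp
      (hμ.map_logMap hlog TangentCone.apex)
    simpa only [Function.comp_def, TangentCone.dist_apex_left] using this
  have hval : ∀ t ∈ Ici (0 : ℝ), frechetFunction (tangentialPushforward μ p) (V.scale t)
      = 1 / 2 * (t ^ 2 * V.length ^ 2 + C) - t * I := by
    intro t ht
    have ht0 : 0 ≤ t := ht
    have hm : Continuous fun X : TangentCone p => dist (V.scale t) X ^ 2 := by fun_prop
    rw [frechetFunction, tangentialPushforward,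
      integral_map hlog hm.measurable.aestronglyMeasurable]
    simp only [TangentCone.dist_sq, TangentCone.length_scale ht0, TangentCone.innerProd_scale ht0]
    have hi := hμ.integrable_innerProd hlog V
    have hsum : Integrable (fun y => (t * V.length) ^ 2 + (logMap p y).length ^ 2) μ :=
      (integrable_const _).add hlen
    rw [integral_sub hsum ((hi.const_mul t).const_mul 2),
      integral_add (integrable_const _) hlen, integral_const_mul, integral_const_mul,
      integral_const, probReal_univ, ← hI, ← hC]
    simp only [smul_eq_mul]
    ring
  have hpoly : HasDerivWithinAt (fun t : ℝ => 1 / 2 * (t ^ 2 * V.length ^ 2 + C) - t * I) (-I)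
      (Ici 0) 0 := by
    have h1 := ((((hasDerivAt_pow 2 (0 : ℝ)).mul_const (V.length ^ 2)).add_const C).const_mul
      (1 / 2)).sub ((hasDerivAt_id (0 : ℝ)).mul_const I)
    refine h1.hasDerivWithinAt.congr_deriv ?_
    simp
  exact hpoly.congr hval (hval 0 self_mem_Ici)

end Integration

/-! ### The proposition -/

theorem propositionp {M : Type*} [MetricSpace M] [MeasurableSpace M] [BorelSpace M]
    (κ : ℝ) (hM : IsCAT κ M)
    (μ : Measure M) [IsProbabilityMeasure μ] (hμ : HasFiniteSecondMoment μ)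
    (p : M) (hloc : IsLocalized μ p)
    -- closed balls are compact, or almost all points are within the model diameter of the mean
    (hreg : (IsGeodesicSpace M ∧ ProperSpace M) ∨ ∀ᵐ x ∂μ, LtModelDiam κ (dist p x)) :
    -- the directional derivative of `F` at `p` exists and depends only on the tangent vector
    (∀ (γ : GeodesicFrom p) (r : ℝ) (hr : 0 < r),
      HasDerivWithinAt (fun t : ℝ => frechetFunction μ (γ.toFun (r * t)))
        (dirDeriv (frechetFunction μ) (TangentCone.ray (Direction.mk γ) r hr)) (Ici 0) 0) ∧
    -- it is a convex function on the tangent cone with its conical metric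
    GeodesicallyConvexOn univ
      (fun V : TangentCone p => dirDeriv (frechetFunction μ) V) ∧
    -- the pushforward is defined and its Fréchet function is finite
    AEMeasurable (logMap p) μ ∧
    HasFiniteSecondMoment (tangentialPushforward μ p) ∧
    -- both directional derivatives agree
    (∀ V : TangentCone p,
      HasDerivWithinAt (fun t : ℝ => frechetFunction (tangentialPushforward μ p) (V.scale t))
        (coneDirDeriv (frechetFunction (tangentialPushforward μ p)) V) (Ici 0) 0 ∧
      dirDeriv (frechetFunction μ) V
        = coneDirDeriv (frechetFunction (tangentialPushforward μ p)) V) := by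
  -- Both alternatives become one pointwise condition. For `κ ≤ 0` the condition `LtModelDiam` holds
  -- vacuously.
  have hgood : ∀ᵐ x ∂μ, HasUniqueShortestPath p x ∧
      ((IsGeodesicSpace M ∧ ProperSpace M) ∨ LtModelDiam κ (dist p x)) := by
    rcases hreg with h | h
    · filter_upwards [hloc.retractable] with x hx using ⟨hx, Or.inl h⟩
    · filter_upwards [hloc.retractable, h] with x hx hx' using ⟨hx, Or.inr hx'⟩
  have hlog := hM.aemeasurable_logMap hgood
  have hdir := fun V : TangentCone p => hM.dirDeriv_frechetFunction hμ hgood V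
  refine ⟨fun γ r hr => ?_, ?_, hlog, hμ.map_logMap hlog, fun V => ?_⟩
  · rw [hdir]
    exact hM.hasDerivWithinAt_frechetFunction_mul hμ hgood γ hr
  · intro c hc _ t ht
    have h0 : (0 : ℝ) ∈ Icc (0 : ℝ) 1 := ⟨le_rfl, zero_le_one⟩
    have h1 : (1 : ℝ) ∈ Icc (0 : ℝ) 1 := ⟨zero_le_one, le_rfl⟩
    have hU : dist (c 0) (c t) = t * dist (c 0) (c 1) := by
      rw [hc 0 h0 t ht, zero_sub, abs_neg, abs_of_nonneg ht.1]
    have hV : dist (c t) (c 1) = (1 - t) * dist (c 0) (c 1) := by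
      rw [hc t ht 1 h1, abs_sub_comm, abs_of_nonneg (by linarith [ht.2])]
    have hint := fun V : TangentCone p => hμ.integrable_innerProd hlog V
    -- Concavity of the inner product against each `logMap p y`, integrated; the minus sign in
    -- `hdir` turns it into convexity.
    have hle : ∫ y, ((1 - t) * (c 0).innerProd (logMap p y) + t * (c 1).innerProd (logMap p y)) ∂μ
        ≤ ∫ y, (c t).innerProd (logMap p y) ∂μ := by
      refine integral_mono (((hint _).const_mul _).add ((hint _).const_mul _)) (hint _) fun y => ?_
      have := hM.innerProd_concave (logMap p y) ht hU hV
      simpa only [TangentCone.innerProd_comm (logMap p y)] using this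
    rw [integral_add ((hint _).const_mul _) ((hint _).const_mul _), integral_const_mul,
      integral_const_mul] at hle
    simp only [hdir]
    linarith
  · have hder := hμ.hasDerivWithinAt_tangentialPushforward hlog V
    have heq : coneDirDeriv (frechetFunction (tangentialPushforward μ p)) V
        = -∫ y, V.innerProd (logMap p y) ∂μ := hder.derivWithin (uniqueDiffWithinAt_Ici 0)
    rw [heq]
    exact ⟨hder, hdir V⟩
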